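/- Let $d$ be fixed. There is a deterministic algorithm on the real RAM (unit-cost exact real arithmetic $+,-,\times,/,\sqrt{\ }$ and comparisons, unit-cost addition, subtraction and comparison of natural numbers, and indirect addressing; no floor function) which, given a set $V\subset\mathbb{R}^d$ of $n\ge 2$ distinct points and an arbitrary point $c\in\mathbb{R}^d$ by their coordinates, computes exactly the dilation $$\Delta_c=\max_{a,b\in V,\ a\neq b}\frac{|ac|+|cb|}{|ab|}$$ of the star with center $c$ and leaves $V$ in $O(n\log n)$ steps, where $|pq|$ denotes Euclidean distance. That is, there are a program $P_d$ and a constant $C_d$, depending only on $d$, such that for all $n\ge 2$ and all such inputs $P_d$ halts after at most $C_d\, n\log n$ steps with output $\Delta_c$. -/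

import Mathlib

/-! A real RAM: exact real numbers with `+, -, *, /, √` and comparisons, natural numbers with
`+`, truncated `-` and comparisons, and indirect addressing, all at unit cost.  There is no floor
function, no conversion of reals to integers, and no integer multiplication.  Programs are finite
structured programs; they may mention only rational constants. -/

namespace RealRAM

/-- A memory state: natural-number registers, real registers, and arrays of natural numbers and of
reals.  `natArr t i` and `realArr t i` are the cells with index `i` of the array with name `t`. A
program names finitely many registers and arrays, by numerals fixed in its text; the index of an
array cell is computed at run time. -/
structure State where
  nat : ℕ → ℕ
  real : ℕ → ℝ
  natArr : ℕ → ℕ → ℕ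
  realArr : ℕ → ℕ → ℝ

/-- Expressions with values in `ℕ`. -/
inductive NExpr where
  | const (m : ℕ)
  | reg (r : ℕ)
  | load (t : ℕ) (i : NExpr)
  | add (e f : NExpr)
  | sub (e f : NExpr)

/-- Expressions with values in `ℝ`. -/
inductive RExpr where
  | const (q : ℚ)
  | reg (r : ℕ)
  | load (t : ℕ) (i : NExpr)
  | add (e f : RExpr)
  | sub (e f : RExpr)
  | mul (e f : RExpr)
  | div (e f : RExpr)
  | sqrt (e : RExpr)

/-- Tests. -/
inductive Test where
  | natLt (e f : NExpr)
  | realLt (e f : RExpr)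
  | not (b : Test)
  | and (b b' : Test)
  | or (b b' : Test)

/-- Value of an expression in a state; subtraction of natural numbers is truncated at `0`. -/
def NExpr.eval (s : State) : NExpr → ℕ
  | .const m => m
  | .reg r => s.nat r
  | .load t i => s.natArr t (i.eval s)
  | .add e f => e.eval s + f.eval s
  | .sub e f => e.eval s - f.eval s

/-- Value of an expression in a state.  Division by `0` and the square root of a negative number
give `0`; a program can test for these cases anyway. -/
noncomputable def RExpr.eval (s : State) : RExpr → ℝ
  | .const q => (q : ℝ)
  | .reg r => s.real r
  | .load t i => s.realArr t (i.eval s)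
  | .add e f => e.eval s + f.eval s
  | .sub e f => e.eval s - f.eval s
  | .mul e f => e.eval s * f.eval s
  | .div e f => e.eval s / f.eval s
  | .sqrt e => Real.sqrt (e.eval s)

/-- Truth of a test in a state. -/
def Test.Holds (s : State) : Test → Prop
  | .natLt e f => e.eval s < f.eval s
  | .realLt e f => e.eval s < f.eval s
  | .not b => ¬ b.Holds s
  | .and b b' => b.Holds s ∧ b'.Holds s
  | .or b b' => b.Holds s ∨ b'.Holds s

/-- Steps for evaluating an expression: one for each constant, memory access and operation. -/
def NExpr.cost : NExpr → ℕ
  | .const _ => 1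
  | .reg _ => 1
  | .load _ i => i.cost + 1
  | .add e f => e.cost + f.cost + 1
  | .sub e f => e.cost + f.cost + 1

/-- Steps for evaluating an expression: one for each constant, memory access and operation. -/
def RExpr.cost : RExpr → ℕ
  | .const _ => 1
  | .reg _ => 1
  | .load _ i => i.cost + 1
  | .add e f => e.cost + f.cost + 1
  | .sub e f => e.cost + f.cost + 1
  | .mul e f => e.cost + f.cost + 1
  | .div e f => e.cost + f.cost + 1
  | .sqrt e => e.cost + 1

/-- Steps for evaluating a test. -/
def Test.cost : Test → ℕ
  | .natLt e f => e.cost + f.cost + 1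
  | .realLt e f => e.cost + f.cost + 1
  | .not b => b.cost + 1
  | .and b b' => b.cost + b'.cost + 1
  | .or b b' => b.cost + b'.cost + 1

/-- Programs.  `setNat r e` and `setReal r e` assign to a register, `storeNat t i e` and
`storeReal t i e` to the cell with index `i` of array `t`. -/
inductive Program where
  | skip
  | setNat (r : ℕ) (e : NExpr)
  | setReal (r : ℕ) (e : RExpr)
  | storeNat (t : ℕ) (i : NExpr) (e : NExpr)
  | storeReal (t : ℕ) (i : NExpr) (e : RExpr)
  | seq (p q : Program)
  | ite (b : Test) (p q : Program)
  | loop (b : Test) (p : Program)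

/-- `Exec p s s' k`: the program `p`, started in the state `s`, halts in the state `s'` after
exactly `k` steps.  `loop b p` repeats `p` as long as `b` holds. -/
inductive Exec : Program → State → State → ℕ → Prop
  | skip (s : State) : Exec .skip s s 1
  | setNat (s : State) (r : ℕ) (e : NExpr) :
      Exec (.setNat r e) s { s with nat := Function.update s.nat r (e.eval s) } (e.cost + 1)
  | setReal (s : State) (r : ℕ) (e : RExpr) :
      Exec (.setReal r e) s { s with real := Function.update s.real r (e.eval s) } (e.cost + 1)
  | storeNat (s : State) (t : ℕ) (i e : NExpr) :
      Exec (.storeNat t i e) s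
        { s with natArr := Function.update s.natArr t
                  (Function.update (s.natArr t) (i.eval s) (e.eval s)) }
        (i.cost + e.cost + 1)
  | storeReal (s : State) (t : ℕ) (i : NExpr) (e : RExpr) :
      Exec (.storeReal t i e) s
        { s with realArr := Function.update s.realArr t
                  (Function.update (s.realArr t) (i.eval s) (e.eval s)) }
        (i.cost + e.cost + 1)
  | seq {p q : Program} {s s' s'' : State} {k l : ℕ} :
      Exec p s s' k → Exec q s' s'' l → Exec (.seq p q) s s'' (k + l)
  | iteTrue {b : Test} {p q : Program} {s s' : State} {k : ℕ} :
      b.Holds s → Exec p s s' k → Exec (.ite b p q) s s' (b.cost + 1 + k)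
  | iteFalse {b : Test} {p q : Program} {s s' : State} {k : ℕ} :
      ¬ b.Holds s → Exec q s s' k → Exec (.ite b p q) s s' (b.cost + 1 + k)
  | loopDone {b : Test} {p : Program} {s : State} :
      ¬ b.Holds s → Exec (.loop b p) s s (b.cost + 1)
  | loopStep {b : Test} {p : Program} {s s' s'' : State} {k l : ℕ} :
      b.Holds s → Exec p s s' k → Exec (.loop b p) s' s'' l →
      Exec (.loop b p) s s'' (b.cost + 1 + k + l)

/-- The machine is deterministic: final state and number of steps are functions of the input. -/
theorem Exec.unique {p : Program} {s s₁ s₂ : State} {k₁ k₂ : ℕ}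
    (h₁ : Exec p s s₁ k₁) (h₂ : Exec p s s₂ k₂) : s₁ = s₂ ∧ k₁ = k₂ := by
  induction h₁ generalizing s₂ k₂ with
  | skip | setNat | setReal | storeNat | storeReal => cases h₂; exact ⟨rfl, rfl⟩
  | seq _ _ ih ih' =>
    cases h₂ with
    | seq h h' =>
      obtain ⟨rfl, rfl⟩ := ih h
      obtain ⟨rfl, rfl⟩ := ih' h'
      exact ⟨rfl, rfl⟩
  | iteTrue hb _ ih =>
    cases h₂ with
    | iteTrue _ h => obtain ⟨rfl, rfl⟩ := ih h; exact ⟨rfl, rfl⟩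
    | iteFalse hb' _ => exact absurd hb hb'
  | iteFalse hb _ ih =>
    cases h₂ with
    | iteTrue hb' _ => exact absurd hb' hb
    | iteFalse _ h => obtain ⟨rfl, rfl⟩ := ih h; exact ⟨rfl, rfl⟩
  | loopDone hb =>
    cases h₂ with
    | loopDone _ => exact ⟨rfl, rfl⟩
    | loopStep hb' _ _ => exact absurd hb' hb
  | loopStep hb _ _ ih ih' =>
    cases h₂ with
    | loopDone hb' => exact absurd hb hb'
    | loopStep _ h h' =>
      obtain ⟨rfl, rfl⟩ := ih h
      obtain ⟨rfl, rfl⟩ := ih' h'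
      exact ⟨rfl, rfl⟩

end RealRAM

/-- The dilation between the leaves `a` and `b` of the star with center `c`: the length of the
path `a, c, b`, divided by the distance of `a` and `b`. -/
noncomputable def pairDilation {d : ℕ} (c a b : EuclideanSpace ℝ (Fin d)) : ℝ :=
  (dist a c + dist c b) / dist a b

/-- `x` is the dilation of the star with center `c` and leaves `V`: the maximum of the dilations
between two distinct points of `V`. -/
def IsStarDilation {d : ℕ} (c : EuclideanSpace ℝ (Fin d)) (V : Set (EuclideanSpace ℝ (Fin d)))
    (x : ℝ) : Prop :=
  IsGreatest {y : ℝ | ∃ a ∈ V, ∃ b ∈ V, a ≠ b ∧ y = pairDilation c a b} x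

/-- The initial state for the points `v 0, …, v (n - 1)` and the center `c`: the number `n` is in
the natural-number register `0`, the `j`-th coordinate of `v i` is in cell `i` of the real array
`j`, the `j`-th coordinate of `c` is in the real register `j`, and all else is `0`. -/
noncomputable def starInput {d n : ℕ} (v : Fin n → EuclideanSpace ℝ (Fin d))
    (c : EuclideanSpace ℝ (Fin d)) : RealRAM.State where
  nat := fun r => if r = 0 then n else 0
  real := fun r => if h : r < d then c ⟨r, h⟩ else 0
  natArr := fun _ _ => 0
  realArr := fun t i => if h : t < d ∧ i < n then v ⟨i, h.2⟩ ⟨t, h.1⟩ else 0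

/-! # Computing the dilation of a star in time `O(n log n)`

With the center at the origin, the dilation between `a` and `b` is `(‖a‖ + ‖b‖) / ‖a - b‖`.  The
points are sorted by their norms and by the coordinates of their unit vectors.  For the window
lengths `w = 1, 2, 4, …` the program maintains the register `real 0`, a dilation `δ ≥ 1` not
exceeded by that of any two points whose numbers differ by less than `w`.  To double `w`, sweeps in
the sorted orders divide the points into cells whose size is governed by `δ`.  Two points with a
dilation greater than `δ` are in neighbouring cells, while a cell has a bounded number of points
with numbers in a window of length `2 * w`.  So it suffices to compare each point with the last few
points before it in each of the neighbouring cells; they are kept in a directly addressed table of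
queues of constant length. -/

/-! Translate the center to the origin and fix a current value `δ ≥ 1`. If `a`, `b` have dilation
greater than `δ`, the triangle inequality bounds the ratio of their norms by `(δ + 1) / (δ - 1)`,
and the law of cosines bounds the distance of their unit vectors by `2 / δ`. Conversely, closeness
of the same kind with smaller constants forces dilation greater than `δ`
(`mul_norm_sub_lt_of_close`). Hence a cell of the first size splits into boundedly many pieces, each
of which holds at most one point of any set of nonzero points whose pairwise dilations are at most
`δ` (`card_cell_le`).

Suppose `δ` bounds the dilations of all pairs with index difference below `w`. A window of `2 * w`
indices is two windows of length `w`, so it meets each cell in boundedly many points. Every pair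
within the window that beats `δ` lies in neighbouring cells (`exists_cells`) and is found by looking
at a constant number of recent points per cell (`visit_run`). Doubling `w` thus costs linear time
(`level_spec`). The sorted orders do not depend on `δ` and are computed once. With about `log n`
doublings the total is `O(n log n)`.

Neither floor nor hashing is needed. Columns come from sweeps in sorted order, and the cell table is
an array of unbounded extent. The table is never cleared: every entry is always the number of some
point, and a superfluous comparison can only produce the dilation of an actual pair.

Arrays of natural numbers are allotted by residue modulo `4`: sorted orders `0`, weighted columns
`1`, queues `2`, merge buffer `3`. -/

namespace RealRAM

/-! ### Semantics of loop-free programs and rules for the two kinds of loops. -/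

/-- Programs without loops. -/
def Program.LoopFree : Program → Prop
  | .seq p q => p.LoopFree ∧ q.LoopFree
  | .ite _ p q => p.LoopFree ∧ q.LoopFree
  | .loop _ _ => False
  | _ => True

/-- An upper bound for the number of steps of a loop-free program. -/
def Program.bound : Program → ℕ
  | .skip => 1
  | .setNat _ e => e.cost + 1
  | .setReal _ e => e.cost + 1
  | .storeNat _ i e => i.cost + e.cost + 1
  | .storeReal _ i e => i.cost + e.cost + 1
  | .seq p q => p.bound + q.bound
  | .ite b p q => b.cost + 1 + p.bound + q.bound
  | .loop _ _ => 0

/-- The state after setting the natural-number register `r` to `m`. -/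
def State.setNat (s : State) (r m : ℕ) : State where
  nat := Function.update s.nat r m
  real := s.real
  natArr := s.natArr
  realArr := s.realArr

/-- The state after setting the real register `r` to `x`. -/
noncomputable def State.setReal (s : State) (r : ℕ) (x : ℝ) : State where
  nat := s.nat
  real := Function.update s.real r x
  natArr := s.natArr
  realArr := s.realArr

/-- The state after setting cell `i` of the natural-number array `t` to `m`. -/
def State.storeNat (s : State) (t i m : ℕ) : State where
  nat := s.nat
  real := s.real
  natArr := Function.update s.natArr t (Function.update (s.natArr t) i m)
  realArr := s.realArr

/-- The state after setting cell `i` of the real array `t` to `x`. -/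
noncomputable def State.storeReal (s : State) (t i : ℕ) (x : ℝ) : State where
  nat := s.nat
  real := s.real
  natArr := s.natArr
  realArr := Function.update s.realArr t (Function.update (s.realArr t) i x)

@[simp] theorem State.setNat_proj (s : State) (r m : ℕ) :
    (s.setNat r m).nat = Function.update s.nat r m ∧
    (s.setNat r m).real = s.real ∧
    (s.setNat r m).natArr = s.natArr ∧
    (s.setNat r m).realArr = s.realArr :=
  ⟨rfl, rfl, rfl, rfl⟩

@[simp] theorem State.setReal_proj (s : State) (r : ℕ) (x : ℝ) :
    (s.setReal r x).nat = s.nat ∧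
    (s.setReal r x).real = Function.update s.real r x ∧
    (s.setReal r x).natArr = s.natArr ∧
    (s.setReal r x).realArr = s.realArr :=
  ⟨rfl, rfl, rfl, rfl⟩

@[simp] theorem State.storeNat_proj (s : State) (t i m : ℕ) :
    (s.storeNat t i m).nat = s.nat ∧
    (s.storeNat t i m).real = s.real ∧
    (s.storeNat t i m).natArr = Function.update s.natArr t (Function.update (s.natArr t) i m) ∧
    (s.storeNat t i m).realArr = s.realArr :=
  ⟨rfl, rfl, rfl, rfl⟩

@[simp] theorem State.storeReal_proj (s : State) (t i : ℕ) (x : ℝ) :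
    (s.storeReal t i x).nat = s.nat ∧
    (s.storeReal t i x).real = s.real ∧
    (s.storeReal t i x).natArr = s.natArr ∧
    (s.storeReal t i x).realArr = Function.update s.realArr t (Function.update (s.realArr t) i x) :=
  ⟨rfl, rfl, rfl, rfl⟩

open Classical in
/-- The final state of a loop-free program. -/
noncomputable def Program.run : Program → State → State
  | .skip, s => s
  | .setNat r e, s => s.setNat r (e.eval s)
  | .setReal r e, s => s.setReal r (e.eval s)
  | .storeNat t i e, s => s.storeNat t (i.eval s) (e.eval s)
  | .storeReal t i e, s => s.storeReal t (i.eval s) (e.eval s)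
  | .seq p q, s => q.run (p.run s)
  | .ite b p q, s => if b.Holds s then p.run s else q.run s
  | .loop _ _, s => s

@[simp] theorem Program.run_seq (p q : Program) (s : State) :
    (Program.seq p q).run s = q.run (p.run s) := rfl

theorem Program.run_ite_pos {b : Test} {s : State} (h : b.Holds s) (p q : Program) :
    (Program.ite b p q).run s = p.run s := if_pos h

theorem Program.run_ite_neg {b : Test} {s : State} (h : ¬ b.Holds s) (p q : Program) :
    (Program.ite b p q).run s = q.run s := if_neg h

theorem Program.LoopFree.exec {p : Program} (h : p.LoopFree) (s : State) :
    ∃ k ≤ p.bound, Exec p s (p.run s) k := by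
  induction p generalizing s with
  | skip => exact ⟨_, le_rfl, .skip s⟩
  | setNat r e => exact ⟨_, le_rfl, .setNat s r e⟩
  | setReal r e => exact ⟨_, le_rfl, .setReal s r e⟩
  | storeNat t i e => exact ⟨_, le_rfl, .storeNat s t i e⟩
  | storeReal t i e => exact ⟨_, le_rfl, .storeReal s t i e⟩
  | seq p q ihp ihq =>
    obtain ⟨k, hk, hp⟩ := ihp h.1 s
    obtain ⟨l, hl, hq⟩ := ihq h.2 (p.run s)
    exact ⟨_, Nat.add_le_add hk hl, .seq hp hq⟩
  | ite b p q ihp ihq =>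
    by_cases hb : b.Holds s
    · obtain ⟨k, hk, hp⟩ := ihp h.1 s
      refine ⟨b.cost + 1 + k, by simp only [Program.bound]; omega, ?_⟩
      rw [Program.run, if_pos hb]
      exact .iteTrue hb hp
    · obtain ⟨k, hk, hq⟩ := ihq h.2 s
      refine ⟨b.cost + 1 + k, by simp only [Program.bound]; omega, ?_⟩
      rw [Program.run, if_neg hb]
      exact .iteFalse hb hq
  | loop b p => exact h.elim

/-- Total correctness with a bound `T` for the number of steps. -/
def Spec (P : State → Prop) (p : Program) (Q : State → Prop) (T : ℕ) : Prop :=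
  ∀ s, P s → ∃ s' k, Exec p s s' k ∧ Q s' ∧ k ≤ T

theorem Spec.seq {P Q R : State → Prop} {p q : Program} {T U : ℕ}
    (h : Spec P p Q T) (h' : Spec Q q R U) : Spec P (.seq p q) R (T + U) := by
  intro s hs
  obtain ⟨s', k, e, hq, hk⟩ := h s hs
  obtain ⟨s'', l, e', hr, hl⟩ := h' s' hq
  exact ⟨s'', k + l, .seq e e', hr, Nat.add_le_add hk hl⟩

theorem Spec.mono {P P' Q Q' : State → Prop} {p : Program} {T T' : ℕ}
    (h : Spec P p Q T) (hP : ∀ s, P' s → P s) (hQ : ∀ s, Q s → Q' s) (hT : T ≤ T') :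
    Spec P' p Q' T' := by
  intro s hs
  obtain ⟨s', k, e, hq, hk⟩ := h s (hP s hs)
  exact ⟨s', k, e, hQ _ hq, hk.trans hT⟩

theorem Spec.of_run {P Q : State → Prop} {p : Program} (hp : p.LoopFree)
    (h : ∀ s, P s → Q (p.run s)) : Spec P p Q p.bound := by
  intro s hs
  obtain ⟨k, hk, e⟩ := hp.exec s
  exact ⟨_, k, e, h s hs, hk⟩

/-- `p` is repeated with the register `1` running from `0` to `n - 1`, where `n` is the content of
the register `0`. -/
def forLoop (p : Program) : Program :=
  .seq (.setNat 1 (.const 0)) (.loop (.natLt (.reg 1) (.reg 0))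
    (.seq p (.setNat 1 (.add (.reg 1) (.const 1)))))

/-- The loop itself writes register `1`, so the invariant takes the counter as a parameter and must
be insensitive to that register. -/
theorem Spec.forLoop {p : Program} (hp : p.LoopFree) (n : ℕ) (I : ℕ → State → Prop)
    (hI : ∀ i s, I i s → ∀ m, I i (s.setNat 1 m))
    (hstep : ∀ i s, i < n → s.nat 0 = n → s.nat 1 = i → I i s →
      (p.run s).nat 0 = n ∧ (p.run s).nat 1 = i ∧ I (i + 1) (p.run s)) :
    Spec (fun s => s.nat 0 = n ∧ I 0 s) (forLoop p) (fun s => s.nat 0 = n ∧ I n s)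
      ((p.bound + 10) * (n + 1)) := by
  have key : ∀ m i s, i + m = n → s.nat 0 = n → s.nat 1 = i → I i s →
      ∃ s' k, Exec (.loop (.natLt (.reg 1) (.reg 0))
        (.seq p (.setNat 1 (.add (.reg 1) (.const 1))))) s s' k ∧
        (s'.nat 0 = n ∧ I n s') ∧ k ≤ (p.bound + 10) * m + 5 := by
    intro m
    induction m with
    | zero =>
      intro i s hi h0 h1 h
      refine ⟨s, _, .loopDone ?_, ⟨h0, ?_⟩, ?_⟩
      · simp only [Test.Holds, NExpr.eval, h0, h1]; omega
      · rw [← hi]; exact h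
      · simp [Test.cost, NExpr.cost]
    | succ m ih =>
      intro i s hi h0 h1 h
      obtain ⟨g0, g1, g⟩ := hstep i s (by omega) h0 h1 h
      obtain ⟨k, hk, e⟩ := hp.exec s
      have e' : Exec (.setNat 1 (.add (.reg 1) (.const 1))) (p.run s)
          ((p.run s).setNat 1 (i + 1)) 4 := by
        have := Exec.setNat (p.run s) 1 (.add (.reg 1) (.const 1))
        simpa [NExpr.eval, g1, NExpr.cost, State.setNat] using this
      obtain ⟨s'', l, e'', hs'', hl⟩ := ih (i + 1) ((p.run s).setNat 1 (i + 1)) (by omega)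
        (by simp [State.setNat, g0]) (by simp [State.setNat]) (hI _ _ g _)
      refine ⟨s'', _, .loopStep ?_ (.seq e e') e'', hs'', ?_⟩
      · simp only [Test.Holds, NExpr.eval, h0, h1]; omega
      · simp only [Test.cost, NExpr.cost]
        rw [Nat.mul_succ]
        omega
  rintro s ⟨h0, h⟩
  obtain ⟨s', k, e, hs', hk⟩ := key n 0 (s.setNat 1 0) (by omega) (by simpa [State.setNat] using h0)
    (by simp [State.setNat]) (hI _ _ h _)
  refine ⟨s', _, .seq (.setNat s 1 (.const 0)) e, hs', ?_⟩
  simp only [NExpr.cost]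
  rw [Nat.mul_succ]
  omega

/-- `p` is repeated with the register `2` running through the powers of two below the content of
the register `0`. -/
def doublingLoop (p : Program) : Program :=
  .seq (.setNat 2 (.const 1)) (.loop (.natLt (.reg 2) (.reg 0))
    (.seq p (.setNat 2 (.add (.reg 2) (.reg 2)))))

/-- The body may contain loops, so it enters through a specification with a time bound. The last
power of two may overshoot `n`, hence the final `n ≤ i`. -/
theorem Spec.doublingLoop {p : Program} {T : ℕ} (n : ℕ) (I : ℕ → State → Prop)
    (hI : ∀ i s, I i s → ∀ m, I i (s.setNat 2 m))
    (hstep : ∀ i, 1 ≤ i → i < n → Spec (fun s => s.nat 0 = n ∧ s.nat 2 = i ∧ I i s) p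
      (fun s => s.nat 0 = n ∧ s.nat 2 = i ∧ I (2 * i) s) T) :
    Spec (fun s => s.nat 0 = n ∧ I 1 s) (doublingLoop p)
      (fun s => s.nat 0 = n ∧ ∃ i, n ≤ i ∧ I i s) ((T + 10) * (Nat.clog 2 n + 1)) := by
  have key : ∀ m i s, 1 ≤ i → n ≤ i * 2 ^ m → s.nat 0 = n → s.nat 2 = i → I i s →
      ∃ s' k, Exec (.loop (.natLt (.reg 2) (.reg 0))
        (.seq p (.setNat 2 (.add (.reg 2) (.reg 2))))) s s' k ∧
        (s'.nat 0 = n ∧ ∃ i, n ≤ i ∧ I i s') ∧ k ≤ (T + 10) * m + 5 := by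
    intro m
    induction m with
    | zero =>
      intro i s hi hn h0 h1 h
      refine ⟨s, _, .loopDone ?_, ⟨h0, i, by simpa using hn, h⟩, ?_⟩
      · simp only [Test.Holds, NExpr.eval, h0, h1]; simpa using hn
      · simp [Test.cost, NExpr.cost]
    | succ m ih =>
      intro i s hi hn h0 h1 h
      by_cases hlt : i < n
      · obtain ⟨s', k, e, ⟨g0, g1, g⟩, hk⟩ := hstep i hi hlt s ⟨h0, h1, h⟩
        have e' : Exec (.setNat 2 (.add (.reg 2) (.reg 2))) s' (s'.setNat 2 (2 * i)) 4 := by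
          have := Exec.setNat s' 2 (.add (.reg 2) (.reg 2))
          simpa [NExpr.eval, g1, NExpr.cost, State.setNat, two_mul] using this
        obtain ⟨s'', l, e'', hs'', hl⟩ := ih (2 * i) (s'.setNat 2 (2 * i)) (by omega)
          (by rw [pow_succ] at hn; linarith) (by simp [State.setNat, g0])
          (by simp [State.setNat]) (hI _ _ g _)
        refine ⟨s'', _, .loopStep ?_ (.seq e e') e'', hs'', ?_⟩
        · simp only [Test.Holds, NExpr.eval, h0, h1]; omega
        · simp only [Test.cost, NExpr.cost]
          rw [Nat.mul_succ]
          omega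
      · refine ⟨s, _, .loopDone ?_, ⟨h0, i, by omega, h⟩, ?_⟩
        · simp only [Test.Holds, NExpr.eval, h0, h1]; omega
        · simp [Test.cost, NExpr.cost]
  rintro s ⟨h0, h⟩
  obtain ⟨s', k, e, hs', hk⟩ := key (Nat.clog 2 n) 1 (s.setNat 2 1) le_rfl
    (by rw [one_mul]; exact Nat.le_pow_clog (by norm_num) n) (by simpa [State.setNat] using h0)
    (by simp [State.setNat]) (hI _ _ h _)
  refine ⟨s', _, .seq (.setNat s 2 (.const 1)) e, hs', ?_⟩
  simp only [NExpr.cost]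
  rw [Nat.mul_succ]
  omega

/-! ### Bottom-up merge sort. -/

/-- The sequence `x ∘ σ` is nondecreasing on each of the blocks of length `w` of `[0, n)`. -/
def BlockSorted (x : ℕ → ℝ) (σ : ℕ → ℕ) (n w : ℕ) : Prop :=
  ∀ b i k, b * w ≤ i → i ≤ k → k < b * w + w → k < n → x (σ i) ≤ x (σ k)

/-- Every number below `n` is a value of `σ` on `[0, n)`. -/
def Covers (σ : ℕ → ℕ) (n : ℕ) : Prop := ∀ q < n, ∃ i < n, σ i = q

/-- The state of affairs while pairs of neighbouring sorted blocks of length `w` of `σ` are merged: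
`τ` is filled up to `o`, and `[l, mid)` and `[r, e)` are the remaining parts of the blocks that are
being merged. -/
structure Merging (x : ℕ → ℝ) (σ τ : ℕ → ℕ) (n w o l mid r e : ℕ) : Prop where
  ex : ∃ B, (∃ b, B = b * (2 * w)) ∧ mid = min (B + w) n ∧ e = min (B + 2 * w) n ∧ B ≤ l ∧
    ∀ i m, B ≤ i → i < o → (l ≤ m ∧ m < mid ∨ r ≤ m ∧ m < e) → x (τ i) ≤ x (σ m)
  le_mid : l ≤ mid
  mid_le : mid ≤ r
  le_e : r ≤ e
  count : l + r = o + mid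
  sorted : ∀ b i k, b * (2 * w) ≤ i → i ≤ k → k < b * (2 * w) + 2 * w → k < o → x (τ i) ≤ x (τ k)
  covered : ∀ m, (m < l ∨ mid ≤ m ∧ m < r) → ∃ i < o, τ i = σ m

section Merge

variable {x : ℕ → ℝ} {σ τ : ℕ → ℕ} {n w o l mid r e : ℕ}

theorem Merging.init : Merging x σ τ n w 0 0 (min w n) (min w n) (min (2 * w) n) where
  ex := ⟨0, ⟨0, by simp⟩, by simp, by simp, by simp, by omega⟩
  le_mid := by omega
  mid_le := by omega
  le_e := by omega
  count := by omega
  sorted := by omega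
  covered := by omega

/-- Both remainders are empty, so `o = e`. As `o < n`, the end `e` was not cut off by `n`, and `o`
is exactly the start of the next pair of blocks. -/
theorem Merging.refresh (h : Merging x σ τ n w o mid mid e e) (ho : o < n) :
    Merging x σ τ n w o o (min (o + w) n) (min (o + w) n) (min (min (o + w) n + w) n) := by
  obtain ⟨B, ⟨b, rfl⟩, h1, h2, h3, h4⟩ := h.ex
  have hc := h.count
  have hoB : o = b * (2 * w) + 2 * w := by omega
  exact
  { ex := ⟨o, ⟨b + 1, by rw [hoB]; ring⟩, rfl, by omega, le_rfl, by omega⟩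
    le_mid := by omega
    mid_le := by omega
    le_e := by omega
    count := by omega
    sorted := h.sorted
    covered := by
      intro m hm
      exact h.covered m (by have := h.mid_le; omega) }

/-- Everything that remains dominates the output in the current double block. Position `o` is not
before this double block, so only its entries are compared with the new one. -/
theorem Merging.sorted_update (h : Merging x σ τ n w o l mid r e) {v : ℕ}
    (hv : l ≤ v ∧ v < mid ∨ r ≤ v ∧ v < e) :
    ∀ b i k, b * (2 * w) ≤ i → i ≤ k → k < b * (2 * w) + 2 * w → k < o + 1 →
      x (Function.update τ o (σ v) i) ≤ x (Function.update τ o (σ v) k) := by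
  intro b i k hi hik hk ho
  obtain ⟨B, ⟨b', rfl⟩, h1, h2, h3, h4⟩ := h.ex
  have := h.le_mid
  have := h.mid_le
  have := h.le_e
  have := h.count
  rcases Nat.lt_succ_iff_lt_or_eq.1 ho with hlt | rfl
  · rw [Function.update_of_ne (by omega), Function.update_of_ne (by omega)]
    exact h.sorted b i k hi hik hk hlt
  · rcases hik.lt_or_eq with hlt | rfl
    · rw [Function.update_of_ne (by omega), Function.update_self]
      refine h4 i v ?_ hlt hv
      rcases le_or_gt b' b with hb | hb
      · exact (Nat.mul_le_mul_right _ hb).trans hi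
      · have := Nat.mul_le_mul_right (2 * w) hb
        rw [Nat.succ_mul] at this
        omega
    · exact le_rfl

theorem Merging.left (h : Merging x σ τ n w o l mid r e) (hσ : BlockSorted x σ n w) (hl : l < mid)
    (hr : r < e → x (σ l) ≤ x (σ r)) :
    Merging x σ (Function.update τ o (σ l)) n w (o + 1) (l + 1) mid r e := by
  obtain ⟨B, ⟨b, hb⟩, h1, h2, h3, h4⟩ := h.ex
  have i1 := h.le_mid
  have i2 := h.mid_le
  have i3 := h.le_e
  have i4 := h.count
  exact
  { ex := by
      refine ⟨B, ⟨b, hb⟩, h1, h2, by omega, ?_⟩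
      intro i m hi hio hm
      rcases Nat.lt_succ_iff_lt_or_eq.1 hio with hlt | rfl
      · rw [Function.update_of_ne (by omega)]
        exact h4 i m hi hlt (by omega)
      · rw [Function.update_self]
        rcases hm with hm | hm
        -- The interval `[l, mid)` lies in block number `2 * b` of `σ`, and `[r, e)` in block number
        -- `2 * b + 1`.
        · refine hσ (2 * b) l m ?_ (by omega) ?_ (by omega)
          · have : 2 * b * w = B := by rw [hb]; ring
            omega
          · have : 2 * b * w = B := by rw [hb]; ring
            omega
        · refine (hr (by omega)).trans (hσ (2 * b + 1) r m ?_ (by omega) ?_ (by omega))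
          · have : (2 * b + 1) * w = B + w := by rw [hb]; ring
            omega
          · have : (2 * b + 1) * w = B + w := by rw [hb]; ring
            omega
    le_mid := by omega
    mid_le := by omega
    le_e := by omega
    count := by omega
    sorted := h.sorted_update (by omega)
    covered := by
      intro m hm
      by_cases hml : m = l
      · exact ⟨o, by omega, by rw [hml, Function.update_self]⟩
      · obtain ⟨i, hi, hi'⟩ := h.covered m (by omega)
        exact ⟨i, by omega, by rw [Function.update_of_ne (by omega), hi']⟩ }

theorem Merging.right (h : Merging x σ τ n w o l mid r e) (hσ : BlockSorted x σ n w) (hr : r < e)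
    (hl : l < mid → x (σ r) ≤ x (σ l)) :
    Merging x σ (Function.update τ o (σ r)) n w (o + 1) l mid (r + 1) e := by
  obtain ⟨B, ⟨b, hb⟩, h1, h2, h3, h4⟩ := h.ex
  have i1 := h.le_mid
  have i2 := h.mid_le
  have i3 := h.le_e
  have i4 := h.count
  exact
  { ex := by
      refine ⟨B, ⟨b, hb⟩, h1, h2, by omega, ?_⟩
      intro i m hi hio hm
      rcases Nat.lt_succ_iff_lt_or_eq.1 hio with hlt | rfl
      · rw [Function.update_of_ne (by omega)]
        exact h4 i m hi hlt (by omega)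
      · rw [Function.update_self]
        rcases hm with hm | hm
        · refine (hl (by omega)).trans (hσ (2 * b) l m ?_ (by omega) ?_ (by omega))
          · have : 2 * b * w = B := by rw [hb]; ring
            omega
          · have : 2 * b * w = B := by rw [hb]; ring
            omega
        · refine hσ (2 * b + 1) r m ?_ (by omega) ?_ (by omega)
          · have : (2 * b + 1) * w = B + w := by rw [hb]; ring
            omega
          · have : (2 * b + 1) * w = B + w := by rw [hb]; ring
            omega
    le_mid := by omega
    mid_le := by omega
    le_e := by omega
    count := by omega
    sorted := h.sorted_update (by omega)
    covered := by
      intro m hm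
      by_cases hml : m = r
      · exact ⟨o, by omega, by rw [hml, Function.update_self]⟩
      · obtain ⟨i, hi, hi'⟩ := h.covered m (by omega)
        exact ⟨i, by omega, by rw [Function.update_of_ne (by omega), hi']⟩ }

/-- With the output full, the count forces `l = mid` and `r = n`: nothing remains to be moved. -/
theorem Merging.finish (h : Merging x σ τ n w n l mid r e) (hσ : Covers σ n) :
    BlockSorted x τ n (2 * w) ∧ Covers τ n := by
  obtain ⟨B, ⟨b, hb⟩, h1, h2, h3, h4⟩ := h.ex
  have i1 := h.le_mid
  have i2 := h.mid_le
  have i3 := h.le_e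
  have i4 := h.count
  refine ⟨h.sorted, fun q hq => ?_⟩
  obtain ⟨m, hm, rfl⟩ := hσ q hq
  exact h.covered m (by omega)

end Merge

/-- The smaller of `e` and the content of the register `0`. -/
def minReg (e : NExpr) : NExpr := .sub (.reg 0) (.sub (.reg 0) e)

@[simp] theorem eval_minReg (s : State) (e : NExpr) :
    (minReg e).eval s = min (e.eval s) (s.nat 0) := by
  simp only [minReg, NExpr.eval]; omega

/-- Turning to the next two blocks if the current ones have been merged. -/
def mergeRefresh : Program :=
  .ite (.and (.not (.natLt (.reg 3) (.reg 4))) (.not (.natLt (.reg 5) (.reg 6))))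
    (.seq (.setNat 3 (.reg 1)) (.seq (.setNat 4 (minReg (.add (.reg 1) (.reg 2))))
      (.seq (.setNat 5 (.reg 4)) (.setNat 6 (minReg (.add (.reg 5) (.reg 2)))))))
    .skip

/-- Moving the smaller one of the first remaining elements of the two current blocks of the
array `t`, which are sorted by the real array `a`, into the array `3`. -/
def mergePick (a t : ℕ) : Program :=
  .ite (.and (.natLt (.reg 3) (.reg 4)) (.or (.not (.natLt (.reg 5) (.reg 6)))
      (.not (.realLt (.load a (.load t (.reg 5))) (.load a (.load t (.reg 3)))))))
    (.seq (.storeNat 3 (.reg 1) (.load t (.reg 3))) (.setNat 3 (.add (.reg 3) (.const 1))))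
    (.seq (.storeNat 3 (.reg 1) (.load t (.reg 5))) (.setNat 5 (.add (.reg 5) (.const 1))))

/-- One step of merging. -/
def mergeStep (a t : ℕ) : Program := .seq mergeRefresh (mergePick a t)

/-- Merging neighbouring blocks of the array `t`, of the length given by the register `2`. -/
def mergePass (a t : ℕ) : Program :=
  .seq (.seq (.setNat 3 (.const 0)) (.seq (.setNat 4 (minReg (.reg 2)))
      (.seq (.setNat 5 (.reg 4)) (.setNat 6 (minReg (.add (.reg 2) (.reg 2)))))))
    (.seq (forLoop (mergeStep a t)) (forLoop (.storeNat t (.reg 1) (.load 3 (.reg 1)))))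

/-- Sorting the numbers below the content of the register `0` by their values in the real
array `a`. -/
def mergeSort (a t : ℕ) : Program :=
  .seq (forLoop (.storeNat t (.reg 1) (.reg 1))) (doublingLoop (mergePass a t))

/-- The real arrays are `X`, and the arrays of natural numbers other than `t` and `3` are `N`. -/
def Framed (X : ℕ → ℕ → ℝ) (N : ℕ → ℕ → ℕ) (t : ℕ) (s : State) : Prop :=
  s.realArr = X ∧ ∀ t', t' ≠ t → t' ≠ 3 → s.natArr t' = N t'

/-- The loop invariant of `mergePass`. -/
def MergeInv (X : ℕ → ℕ → ℝ) (N : ℕ → ℕ → ℕ) (a t n w o : ℕ) (s : State) : Prop :=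
  s.nat 2 = w ∧ Framed X N t s ∧ BlockSorted (X a) (s.natArr t) n w ∧ Covers (s.natArr t) n ∧
    Merging (X a) (s.natArr t) (s.natArr 3) n w o (s.nat 3) (s.nat 4) (s.nat 5) (s.nat 6)

theorem mergePick_run {X : ℕ → ℕ → ℝ} {N : ℕ → ℕ → ℕ} {a t n w o : ℕ} (ht : t ≠ 3) {s : State}
    (h0 : s.nat 0 = n) (h1 : s.nat 1 = o) (h : MergeInv X N a t n w o s)
    (hlr : s.nat 3 < s.nat 4 ∨ s.nat 5 < s.nat 6) :
    ((mergePick a t).run s).nat 0 = n ∧ ((mergePick a t).run s).nat 1 = o ∧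
      MergeInv X N a t n w (o + 1) ((mergePick a t).run s) := by
  obtain ⟨h2, hf, hb, hc, hm⟩ := h
  simp only [mergePick, Program.run, Test.Holds, NExpr.eval, RExpr.eval, hf.1, not_lt]
  split_ifs with hif
  · have := hm.left hb hif.1 (fun h => hif.2.resolve_left (by omega))
    simp [Function.update_apply, ht, h0, h1, h2, hb, hc, Framed, hf.1, MergeInv]
    refine ⟨fun t' h h' => by simp [h', hf.2 t' h h'], ?_⟩
    convert this using 1
  · have := hm.right hb (by omega) (fun h => by
      by_contra h'
      exact hif ⟨h, .inr (le_of_not_ge h')⟩)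
    simp [Function.update_apply, ht, h0, h1, h2, hb, hc, Framed, hf.1, MergeInv]
    refine ⟨fun t' h h' => by simp [h', hf.2 t' h h'], ?_⟩
    convert this using 1

theorem mergePass_spec (X : ℕ → ℕ → ℝ) (N : ℕ → ℕ → ℕ) (a t n w : ℕ) (ht : t ≠ 3) (hw : 0 < w) :
    Spec (fun s => s.nat 0 = n ∧ s.nat 2 = w ∧ Framed X N t s ∧
        BlockSorted (X a) (s.natArr t) n w ∧ Covers (s.natArr t) n) (mergePass a t)
      (fun s => s.nat 0 = n ∧ s.nat 2 = w ∧ Framed X N t s ∧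
        BlockSorted (X a) (s.natArr t) n (2 * w) ∧ Covers (s.natArr t) n)
      (200 * (n + 1)) := by
  have h1 : Spec (fun s => s.nat 0 = n ∧ s.nat 2 = w ∧ Framed X N t s ∧
        BlockSorted (X a) (s.natArr t) n w ∧ Covers (s.natArr t) n)
      (.seq (.setNat 3 (.const 0)) (.seq (.setNat 4 (minReg (.reg 2)))
        (.seq (.setNat 5 (.reg 4)) (.setNat 6 (minReg (.add (.reg 2) (.reg 2)))))))
      (fun s => s.nat 0 = n ∧ MergeInv X N a t n w 0 s)
      100 := by
    refine (Spec.of_run (by simp [Program.LoopFree]) ?_).mono (fun s h => h) (fun s h => h)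
      (by simp [Program.bound, NExpr.cost, minReg])
    rintro s ⟨h0, h2, hf, hb, hc⟩
    have := Merging.init (x := X a) (σ := s.natArr t) (τ := s.natArr 3) (n := n) (w := w)
    simp only [Program.run]
    simp [NExpr.eval, h0, h2, hb, hc, ← two_mul, this, Framed, MergeInv] at hf ⊢
    exact hf
  have h2 := Spec.forLoop (p := mergeStep a t) (by simp [mergeStep, mergeRefresh, mergePick, Program.LoopFree]) n
    (MergeInv X N a t n w)
    (fun _ _ h _ => h)
    (by
      rintro o s ho h0 h1 h
      by_cases hif : s.nat 3 < s.nat 4 ∨ s.nat 5 < s.nat 6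
      · have e : mergeRefresh.run s = s :=
          Program.run_ite_neg (by simp only [Test.Holds, NExpr.eval]; omega) _ _
        rw [mergeStep, Program.run_seq, e]
        exact mergePick_run ht h0 h1 h hif
      · have e := Program.run_ite_pos (b := (.and (.not (.natLt (.reg 3) (.reg 4)))
            (.not (.natLt (.reg 5) (.reg 6))))) (s := s)
            (by simp only [Test.Holds, NExpr.eval]; omega)
            (.seq (.setNat 3 (.reg 1)) (.seq (.setNat 4 (minReg (.add (.reg 1) (.reg 2))))
              (.seq (.setNat 5 (.reg 4)) (.setNat 6 (minReg (.add (.reg 5) (.reg 2))))))) .skip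
        obtain ⟨h2, hf, hb, hc, hm⟩ := h
        have e1 : s.nat 3 = s.nat 4 := by have := hm.le_mid; omega
        have e2 : s.nat 5 = s.nat 6 := by have := hm.le_e; omega
        rw [e1, e2] at hm
        have hm' := hm.refresh ho
        rw [mergeStep, Program.run_seq, mergeRefresh, e]
        apply mergePick_run ht <;> simp [Program.run, NExpr.eval, h0, h1, h2,
          hb, hc, hf.1, Framed, MergeInv]
        · exact ⟨hf.2, hm'⟩
        · omega)
  have h3 := Spec.forLoop (p := .storeNat t (.reg 1) (.load 3 (.reg 1)))
    (by simp [Program.LoopFree]) n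
    (fun i s => s.nat 2 = w ∧ Framed X N t s ∧ BlockSorted (X a) (s.natArr 3) n (2 * w) ∧
      Covers (s.natArr 3) n ∧ ∀ k < i, s.natArr t k = s.natArr 3 k)
    (fun _ _ h _ => h)
    (by
      rintro i s hi h0 h1 ⟨h2, hf, hb, hc, hm⟩
      simp [Program.run, Function.update_apply, NExpr.eval, h0, h1, h2, ht.symm, hb, hc, hf.1, Framed]
      refine ⟨fun t' h h' => by simp [h, hf.2 t' h h'], fun k hk => ?_⟩
      split_ifs with h
      · rw [h]
      · exact hm k (by omega))
  refine (h1.seq (h2.seq (U := 20 * (n + 1)) ?_)).mono (fun s h => h) (fun s h => h) ?_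
  · refine h3.mono ?_ ?_ ?_
    · rintro s ⟨h0, h2, hf, hb, hc, hm⟩
      obtain ⟨hb', hc'⟩ := hm.finish hc
      exact ⟨h0, h2, hf, hb', hc', by simp⟩
    · rintro s ⟨h0, h2, hf, hb, hc, hm⟩
      refine ⟨h0, h2, hf, fun b i k h h' h'' h3 => ?_, fun q hq => ?_⟩
      · rw [hm i (by omega), hm k h3]; exact hb b i k h h' h'' h3
      · obtain ⟨i, hi, rfl⟩ := hc q hq
        exact ⟨i, hi, hm i hi⟩
    · simp only [Program.bound, NExpr.cost]; gcongr; norm_num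
  · simp only [Program.bound, NExpr.cost, mergeStep, mergeRefresh, mergePick, Test.cost, RExpr.cost, minReg]; omega

/-- The sequence `σ` enumerates the numbers below `n` by nondecreasing value of `x`. -/
def SortedBy (x : ℕ → ℝ) (σ : ℕ → ℕ) (n : ℕ) : Prop :=
  (∀ i k, i ≤ k → k < n → x (σ i) ≤ x (σ k)) ∧ Covers σ n

theorem mergeSort_spec (X : ℕ → ℕ → ℝ) (N : ℕ → ℕ → ℕ) (a t n : ℕ) (ht : t ≠ 3) :
    Spec (fun s => s.nat 0 = n ∧ Framed X N t s) (mergeSort a t)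
      (fun s => s.nat 0 = n ∧ Framed X N t s ∧ SortedBy (X a) (s.natArr t) n)
      (300 * (n + 1) * (Nat.clog 2 n + 1)) := by
  have h1 := Spec.forLoop (p := .storeNat t (.reg 1) (.reg 1)) (by simp [Program.LoopFree]) n
    (fun i s => Framed X N t s ∧ ∀ k < i, s.natArr t k = k)
    (fun _ _ h _ => h)
    (by
      rintro i s hi h0 h1 ⟨hf, hm⟩
      simp [Program.run, Function.update_apply, NExpr.eval, h0, h1, hf.1, Framed]
      refine ⟨fun t' h h' => by simp [h, hf.2 t' h h'], fun k hk => ?_⟩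
      split_ifs with h
      · exact h.symm
      · exact hm k (by omega))
  have h2 := Spec.doublingLoop (p := mergePass a t) n
    (fun w s => Framed X N t s ∧ BlockSorted (X a) (s.natArr t) n w ∧ Covers (s.natArr t) n)
    (fun _ _ h _ => h)
    (fun w hw _ => mergePass_spec X N a t n w ht hw)
  refine (h1.seq (h2.mono ?_ (fun s h => h) le_rfl)).mono ?_ ?_ ?_
  · rintro s ⟨h0, hf, hm⟩
    refine ⟨h0, hf, fun b i k h h' h'' h3 => ?_, fun q hq => ⟨q, hq, hm q hq⟩⟩
    rw [show i = k by omega]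
  · rintro s ⟨h0, hf⟩
    exact ⟨h0, hf, by simp⟩
  · rintro s ⟨h0, w, hw, hf, hb, hc⟩
    refine ⟨h0, hf, fun i k hik hk => hb 0 i k (by omega) hik (by omega) hk, hc⟩
  · simp only [Program.bound, NExpr.cost]
    nlinarith [Nat.zero_le (n * Nat.clog 2 n), Nat.zero_le (Nat.clog 2 n)]

/-! ### Sweeps that cut a sorted sequence into columns. -/

open Classical in
/-- Sweeping over the sequence `y`: the start of the current column and its number.  A new column
is started at `y i` if the distance from the start, as measured by `A`, `B` and `C`, is large. -/
noncomputable def sweepState (A B C : ℝ) (y : ℕ → ℝ) : ℕ → ℝ × ℕ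
  | 0 => (y 0, 0)
  | i + 1 => if A * (sweepState A B C y i).1 + B < C * y i then
      (y i, (sweepState A B C y i).2 + 1) else sweepState A B C y i

section Sweep

variable {A B C : ℝ} {y : ℕ → ℝ} {n : ℕ}

theorem sweepState_mono : Monotone fun i => (sweepState A B C y i).2 := by
  refine monotone_nat_of_le_succ fun i => ?_
  simp only [sweepState]
  split_ifs <;> simp

/-- Entry `i + 1` is the state after reading `y i`, so it describes the column of `y i`.
Irreflexivity of the test covers the case that `y i` has just started its own column. -/
theorem sweepState_fst (hy : ∀ i k, i ≤ k → k < n → y i ≤ y k)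
    (hirr : ∀ i < n, ¬ A * y i + B < C * y i) {i : ℕ} (hi : i < n) :
    (sweepState A B C y (i + 1)).1 ≤ y i ∧
      ¬ A * (sweepState A B C y (i + 1)).1 + B < C * y i := by
  induction i with
  | zero =>
    rw [sweepState]
    split_ifs with h
    · exact ⟨le_rfl, hirr 0 hi⟩
    · exact ⟨le_rfl, h⟩
  | succ i ih =>
    rw [sweepState]
    split_ifs with h
    · exact ⟨le_rfl, hirr _ hi⟩
    · exact ⟨(ih (by omega)).1.trans (hy _ _ (by omega) hi), h⟩

/-- Equal column numbers mean a common start, which is at most `y k`; the failed test against the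
start gives the failed test against `y k`. -/
theorem sweepState_same (hA : 0 ≤ A) (hy : ∀ i k, i ≤ k → k < n → y i ≤ y k)
    (hirr : ∀ i < n, ¬ A * y i + B < C * y i) {k m : ℕ} (hkm : k ≤ m) (hm : m < n)
    (h : (sweepState A B C y (m + 1)).2 = (sweepState A B C y (k + 1)).2) :
    ¬ A * y k + B < C * y m := by
  have key : ∀ m, k ≤ m →
      (sweepState A B C y (m + 1)).2 = (sweepState A B C y (k + 1)).2 →
      (sweepState A B C y (m + 1)).1 = (sweepState A B C y (k + 1)).1 := by
    intro m hkm
    induction m, hkm using Nat.le_induction with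
    | base => simp
    | succ m hkm ih =>
      intro h
      have h1 := sweepState_mono (A := A) (B := B) (C := C) (y := y) (show k + 1 ≤ m + 1 by omega)
      rw [sweepState] at h ⊢
      split_ifs at h ⊢ with h'
      · simp only at h h1; omega
      · exact ih h
  have h1 := sweepState_fst hy hirr hm
  rw [key m hkm h] at h1
  have h2 := (sweepState_fst hy hirr (hkm.trans_lt hm)).1
  have := mul_le_mul_of_nonneg_left h2 hA
  intro h3
  exact h1.2 (by linarith)

/-- The first new column after `y k` starts at a value at least `y k`. Leaving that column as well
would exceed the test against its start, hence also the test against `y k`. -/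
theorem sweepState_near (hA : 0 ≤ A) (hC : 0 ≤ C) (hy : ∀ i k, i ≤ k → k < n → y i ≤ y k)
    {k m : ℕ} (hkm : k ≤ m) (hm : m < n) (h : ¬ A * y k + B < C * y m) :
    (sweepState A B C y (m + 1)).2 ≤ (sweepState A B C y (k + 1)).2 + 1 := by
  have key : (sweepState A B C y (m + 1)).2 = (sweepState A B C y (k + 1)).2 ∨
      ((sweepState A B C y (m + 1)).2 = (sweepState A B C y (k + 1)).2 + 1 ∧
        y k ≤ (sweepState A B C y (m + 1)).1) ∨ A * y k + B < C * y m := by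
    clear h
    induction m, hkm using Nat.le_induction with
    | base => simp
    | succ m hkm ih =>
      rcases ih (by omega) with h | ⟨h, h'⟩ | h
      · rw [sweepState]
        split_ifs with hif
        · right; left
          exact ⟨by simp [h], hy _ _ (by omega) hm⟩
        · exact .inl h
      · rw [sweepState]
        split_ifs with hif
        · right; right
          have := mul_le_mul_of_nonneg_left h' hA
          linarith
        · exact .inr (.inl ⟨h, h'⟩)
      · right; right
        have := mul_le_mul_of_nonneg_left (hy m (m + 1) (by omega) hm) hC
        linarith
  rcases key with h' | ⟨h', -⟩ | h'
  · omega
  · omega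
  · exact absurd h' h

end Sweep

/-- A division of the numbers below `n` into columns by the value of `x`: elements close to each
other are in the same column or in neighbouring ones, and elements of the same column are close to
each other. -/
structure Columns (A B C : ℝ) (x : ℕ → ℝ) (n : ℕ) (col : ℕ → ℕ) (M : ℕ) : Prop where
  le : ∀ q < n, col q ≤ M
  near : ∀ p < n, ∀ q < n, x p ≤ x q → ¬ A * x p + B < C * x q →
    col p ≤ col q + 1 ∧ col q ≤ col p + 1
  same : ∀ p < n, ∀ q < n, col p = col q → x p ≤ x q → ¬ A * x p + B < C * x q

theorem Columns.of_sweep {A B C : ℝ} {x : ℕ → ℝ} {n : ℕ} {σ col : ℕ → ℕ} (hA : 0 ≤ A) (hC : 0 ≤ C)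
    (hσ : ∀ i k, i ≤ k → k < n → x (σ i) ≤ x (σ k))
    (hirr : ∀ q, ¬ A * x q + B < C * x q)
    (hcol : ∀ q < n, ∃ k < n, σ k = q ∧
      col q = (sweepState A B C (fun i => x (σ i)) (k + 1)).2) :
    Columns A B C x n col (sweepState A B C (fun i => x (σ i)) n).2 where
  le q hq := by
    obtain ⟨k, hk, -, h⟩ := hcol q hq
    rw [h]
    exact sweepState_mono hk
  near p hp q hq hpq h := by
    obtain ⟨k, hk, rfl, h1⟩ := hcol p hp
    obtain ⟨m, hm, rfl, h2⟩ := hcol q hq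
    rw [h1, h2]
    rcases le_total k m with hkm | hkm
    · have e1 := sweepState_near (y := fun i => x (σ i)) hA hC hσ hkm hm h
      have e2 := sweepState_mono (A := A) (B := B) (C := C) (y := fun i => x (σ i))
        (Nat.add_le_add_right hkm 1)
      simp only at e2
      omega
    -- Here positions and values are ordered oppositely, so the values coincide and irreflexivity of
    -- the test replaces closeness.
    · have e0 := le_antisymm hpq (hσ m k hkm hk)
      have e1 := sweepState_near (y := fun i => x (σ i)) hA hC hσ hkm hk (B := B)
        (by rw [← e0]; exact hirr _)
      have e2 := sweepState_mono (A := A) (B := B) (C := C) (y := fun i => x (σ i))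
        (Nat.add_le_add_right hkm 1)
      simp only at e2
      omega
  same p hp q hq hpq hle := by
    obtain ⟨k, hk, rfl, h1⟩ := hcol p hp
    obtain ⟨m, hm, rfl, h2⟩ := hcol q hq
    rw [h1, h2] at hpq
    rcases le_total k m with hkm | hkm
    · exact sweepState_same (y := fun i => x (σ i)) hA hσ (fun i _ => hirr _) hkm hm hpq.symm
    · have e0 := le_antisymm hle (hσ m k hkm hk)
      rw [← e0]
      exact hirr _

/-- One step of the sweep over the real array `a` in the order given by the array `t`.  The column
numbers are multiplied by the weight in register `w` and stored in the array `u`. -/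
def sweepStep (a t u w : ℕ) : Program :=
  .seq (.ite (.realLt (.add (.mul (.reg 3) (.reg 2)) (.reg 4))
      (.mul (.reg 5) (.load a (.load t (.reg 1)))))
    (.seq (.setReal 2 (.load a (.load t (.reg 1)))) (.setNat 7 (.add (.reg 7) (.reg w)))) .skip)
    (.storeNat u (.load t (.reg 1)) (.reg 7))

/-- The sweep over the real array `a`, with the parameters given by the real expressions. -/
def sweep (eA eB eC : RExpr) (a t u w : ℕ) : Program :=
  .seq (.seq (.setReal 3 eA) (.seq (.setReal 4 eB) (.seq (.setReal 5 eC)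
      (.seq (.setReal 2 (.load a (.load t (.const 0)))) (.setNat 7 (.const 0))))))
    (.seq (forLoop (sweepStep a t u w))
      (.setNat (w + 1) (.add (.reg 7) (.add (.reg w) (.add (.reg w) (.reg w))))))

/-- The states that may be reached from `s₀` by a sweep with the weight register `w` and the
target array `u`. -/
structure SweepFrame (s₀ : State) (u w : ℕ) (s : State) : Prop where
  nat : ∀ r, r ≠ 1 → r ≠ 7 → r ≠ w + 1 → s.nat r = s₀.nat r
  real : s.real 0 = s₀.real 0
  natArr : ∀ t, t ≠ u → s.natArr t = s₀.natArr t
  realArr : s.realArr = s₀.realArr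

/-- Natural numbers cannot be multiplied, so register `7` counts columns in units of the weight, and
the next weight comes from three further additions. The factor `M + 3` allows for the `M + 1`
columns and an empty one on either side. -/
theorem sweep_spec (s₀ : State) (eA eB eC : RExpr) (A B C : ℝ) (a t u w n : ℕ)
    (htu : t ≠ u) (hw : 7 < w) (h0 : s₀.nat 0 = n)
    (hA : ∀ s, s.real 0 = s₀.real 0 → eA.eval s = A)
    (hB : ∀ s, s.real 0 = s₀.real 0 → eB.eval s = B)
    (hC : ∀ s, s.real 0 = s₀.real 0 → eC.eval s = C) (hA0 : 0 ≤ A) (hC0 : 0 ≤ C)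
    (hirr : ∀ q, ¬ A * s₀.realArr a q + B < C * s₀.realArr a q)
    (hσ : SortedBy (s₀.realArr a) (s₀.natArr t) n) :
    Spec (fun s => s = s₀) (sweep eA eB eC a t u w)
      (fun s => SweepFrame s₀ u w s ∧ ∃ col M, Columns A B C (s₀.realArr a) n col M ∧
        (∀ q < n, s.natArr u q = col q * s₀.nat w) ∧ s.nat (w + 1) = (M + 3) * s₀.nat w)
      ((eA.cost + eB.cost + eC.cost + 60) * (n + 1)) := by
  set y : ℕ → ℝ := fun i => s₀.realArr a (s₀.natArr t i) with hy
  have hyi : ∀ i, y i = s₀.realArr a (s₀.natArr t i) := fun _ => rfl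
  set I : ℕ → State → Prop := fun i s => SweepFrame s₀ u w s ∧ s.real 3 = A ∧ s.real 4 = B ∧
    s.real 5 = C ∧ s.real 2 = (sweepState A B C y i).1 ∧
    s.nat 7 = (sweepState A B C y i).2 * s₀.nat w ∧
    -- Allowing `k'` instead of `k` makes injectivity of the order unnecessary: the stored column is
    -- that of the last position at which the number occurred.
    ∀ k < i, ∃ k' < i, s₀.natArr t k' = s₀.natArr t k ∧
      s.natArr u (s₀.natArr t k) = (sweepState A B C y (k' + 1)).2 * s₀.nat w with hI
  have h1 : Spec (fun s => s = s₀) (.seq (.setReal 3 eA) (.seq (.setReal 4 eB) (.seq (.setReal 5 eC)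
      (.seq (.setReal 2 (.load a (.load t (.const 0)))) (.setNat 7 (.const 0))))))
      (fun s => s.nat 0 = n ∧ I 0 s) (eA.cost + eB.cost + eC.cost + 10) := by
    refine (Spec.of_run (by simp [Program.LoopFree]) ?_).mono (fun s h => h) (fun s h => h)
      (by simp only [Program.bound, NExpr.cost, RExpr.cost]; omega)
    rintro s rfl
    simp only [hI, Program.run]
    refine ⟨by simpa using h0, ⟨?_, ?_, ?_, ?_⟩, ?_, ?_, ?_, ?_, ?_, ?_⟩ <;>
      simp [Function.update_apply, hA, hB, hC, RExpr.eval, NExpr.eval, sweepState, hy]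
    · intro r _ h h'; simp [h]
  have h2 := Spec.forLoop (p := sweepStep a t u w) (by simp [sweepStep, Program.LoopFree]) n I
    (by
      rintro i s ⟨hf, h⟩ m
      exact ⟨⟨fun r h h' h'' => by simp [h, hf.nat r h h' h''], hf.real, hf.natArr, hf.realArr⟩, h⟩)
    (by
      rintro i s hi g0 g1 ⟨hf, h3, h4, h5, h6, h7, h8⟩
      have e1 : s.natArr t = s₀.natArr t := hf.natArr t htu
      have e2 : s.nat w = s₀.nat w := hf.nat w (by omega) (by omega) (by omega)
      rw [sweepStep, Program.run_seq]
      have e3 : (sweepState A B C y (i + 1)) = if A * (sweepState A B C y i).1 + B < C * y i then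
        (y i, (sweepState A B C y i).2 + 1) else sweepState A B C y i := by rw [sweepState]
      have key : ∀ (s' : State) (p : Program), p = .storeNat u (.load t (.reg 1)) (.reg 7) →
          s'.nat 0 = n → s'.nat 1 = i → SweepFrame s₀ u w s' → s'.real 3 = A → s'.real 4 = B →
          s'.real 5 = C → s'.real 2 = (sweepState A B C y (i + 1)).1 →
          s'.nat 7 = (sweepState A B C y (i + 1)).2 * s₀.nat w → s'.natArr u = s.natArr u →
          (p.run s').nat 0 = n ∧ (p.run s').nat 1 = i ∧ I (i + 1) (p.run s') := by
        rintro s' p rfl h0 h1 hf' h3 h4 h5 h6 h7 h9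
        have e1 : s'.natArr t = s₀.natArr t := hf'.natArr t htu
        simp only [Program.run, NExpr.eval, h1, h7, e1]
        refine ⟨by simpa using h0, by simpa using h1, ⟨hf'.nat, hf'.real, ?_, hf'.realArr⟩,
          h3, h4, h5, h6, h7, ?_⟩
        · intro t' ht'
          simp [ht', hf'.natArr t' ht']
        · intro k hk
          by_cases hk' : s₀.natArr t k = s₀.natArr t i
          · exact ⟨i, by omega, hk'.symm, by simp [hk']⟩
          · obtain ⟨k', h, h', h''⟩ := h8 k (by
              rcases Nat.lt_succ_iff_lt_or_eq.1 hk with h | h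
              · exact h
              · exact absurd (by rw [h]) hk')
            exact ⟨k', by omega, h', by simp [hk', h9, h'']⟩
      by_cases hif : A * (sweepState A B C y i).1 + B < C * y i
      · rw [Program.run_ite_pos (by
          simpa only [Test.Holds, RExpr.eval, NExpr.eval, h3, h4, h5, h6, e1, g1, hf.realArr])]
        rw [if_pos hif] at e3
        refine key _ _ rfl ?_ ?_ ⟨?_, ?_, ?_, ?_⟩ ?_ ?_ ?_ ?_ ?_ ?_ <;>
          simp [Program.run, Function.update_apply, NExpr.eval, RExpr.eval, g0, g1, hf.real, hf.realArr,
            h3, h4, h5, e3, e1, e2, h7, hyi]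
        · intro r h h' h''; simp [h', hf.nat r h h' h'']
        · exact hf.natArr
        · ring
      · rw [Program.run_ite_neg (by
          simpa only [Test.Holds, RExpr.eval, NExpr.eval, h3, h4, h5, h6, e1, g1, hf.realArr])]
        rw [if_neg hif] at e3
        exact key _ _ rfl g0 g1 hf h3 h4 h5 (by rw [e3]; exact h6) (by rw [e3]; exact h7) rfl)
  have h3 : Spec (fun s => s.nat 0 = n ∧ I n s)
      (.setNat (w + 1) (.add (.reg 7) (.add (.reg w) (.add (.reg w) (.reg w)))))
      (fun s => SweepFrame s₀ u w s ∧ ∃ col M, Columns A B C (s₀.realArr a) n col M ∧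
        (∀ q < n, s.natArr u q = col q * s₀.nat w) ∧ s.nat (w + 1) = (M + 3) * s₀.nat w) 10 := by
    refine (Spec.of_run (by simp [Program.LoopFree]) ?_).mono (fun s h => h) (fun s h => h)
      (by simp only [Program.bound, NExpr.cost]; omega)
    rintro s ⟨g0, hf, h3, h4, h5, h6, h7, h8⟩
    have e2 : s.nat w = s₀.nat w := hf.nat w (by omega) (by omega) (by omega)
    have hcol : ∀ q, ∃ c, q < n → (∃ k < n, s₀.natArr t k = q ∧
        c = (sweepState A B C y (k + 1)).2) ∧ s.natArr u q = c * s₀.nat w := by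
      intro q
      by_cases hq : q < n
      · obtain ⟨k, hk, rfl⟩ := hσ.2 q hq
        obtain ⟨k', hk', h, h'⟩ := h8 k hk
        exact ⟨_, fun _ => ⟨⟨k', hk', h, rfl⟩, h'⟩⟩
      · exact ⟨0, fun h => absurd h hq⟩
    choose col hcol using hcol
    refine ⟨⟨fun r h h' h'' => ?_, hf.real, hf.natArr, hf.realArr⟩, col, _,
      Columns.of_sweep hA0 hC0 hσ.1 hirr (fun q hq => (hcol q hq).1), fun q hq => (hcol q hq).2, ?_⟩
    · simp [Program.run, h'', hf.nat r h h' h'']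
    · simp only [Program.run, NExpr.eval, State.setNat_proj, Function.update_self, h7, e2, hy]
      ring
  refine (h1.seq (h2.seq h3)).mono (fun s h => h) (fun s h => h) ?_
  simp only [Program.bound, NExpr.cost, sweepStep, Test.cost, RExpr.cost]
  nlinarith [Nat.zero_le ((eA.cost + eB.cost + eC.cost) * n)]

end RealRAM

/-! ### Geometry of pairs with large dilation, and the packing bound for cells. -/

section Geometry

variable {d : ℕ}

/-- The law of cosines, with the angle expressed by the chord between the unit vectors. -/
theorem sum_sq_unit_sub {a b : EuclideanSpace ℝ (Fin d)} (ha : a ≠ 0) (hb : b ≠ 0) :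
    ‖a - b‖ ^ 2 = (‖a‖ - ‖b‖) ^ 2 + ‖a‖ * ‖b‖ * ∑ j, (a j / ‖a‖ - b j / ‖b‖) ^ 2 := by
  have hA : ‖a‖ ≠ 0 := norm_ne_zero_iff.2 ha
  have hB : ‖b‖ ≠ 0 := norm_ne_zero_iff.2 hb
  have e1 : ∑ j, (a j / ‖a‖ - b j / ‖b‖) ^ 2 = (∑ j, a j ^ 2) / ‖a‖ ^ 2 + (∑ j, b j ^ 2) / ‖b‖ ^ 2
      - 2 * (∑ j, a j * b j) / (‖a‖ * ‖b‖) := by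
    rw [Finset.mul_sum, Finset.sum_div, Finset.sum_div, Finset.sum_div, ← Finset.sum_add_distrib,
      ← Finset.sum_sub_distrib]
    refine Finset.sum_congr rfl fun j _ => ?_
    field_simp
    ring
  have e2 : ‖a - b‖ ^ 2 = ‖a‖ ^ 2 + ‖b‖ ^ 2 - 2 * ∑ j, a j * b j := by
    rw [EuclideanSpace.real_norm_sq_eq, EuclideanSpace.real_norm_sq_eq,
      EuclideanSpace.real_norm_sq_eq, Finset.mul_sum, ← Finset.sum_add_distrib,
      ← Finset.sum_sub_distrib]
    refine Finset.sum_congr rfl fun j _ => ?_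
    simp only [PiLp.sub_apply]
    ring
  rw [e1, e2, ← EuclideanSpace.real_norm_sq_eq, ← EuclideanSpace.real_norm_sq_eq]
  field_simp
  ring

theorem not_lt_of_mul_norm_sub_lt {a b : EuclideanSpace ℝ (Fin d)} {Δ : ℝ} (h : Δ * ‖a - b‖ < ‖a‖ + ‖b‖) (hΔ : 1 ≤ Δ) :
    ¬ (Δ + 1) * ‖a‖ < (Δ - 1) * ‖b‖ := by
  have h1 : ‖b‖ - ‖a‖ ≤ ‖a - b‖ := by rw [norm_sub_rev]; exact norm_sub_norm_le b a
  have := mul_le_mul_of_nonneg_left h1 (by linarith : (0:ℝ) ≤ Δ)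
  intro h2
  linarith

/-- If one of two distinct points is the center, their dilation is exactly `1`. -/
theorem ne_zero_of_mul_norm_sub_lt {a b : EuclideanSpace ℝ (Fin d)} {Δ : ℝ} (h : Δ * ‖a - b‖ < ‖a‖ + ‖b‖) (hΔ : 1 ≤ Δ) :
    a ≠ 0 ∧ b ≠ 0 := by
  constructor
  · rintro rfl
    simp only [zero_sub, norm_neg, norm_zero, zero_add] at h
    nlinarith [norm_nonneg b]
  · rintro rfl
    simp only [sub_zero, norm_zero, add_zero] at h
    nlinarith [norm_nonneg a]

theorem abs_unit_sub_le_of_mul_norm_sub_lt {a b : EuclideanSpace ℝ (Fin d)} {Δ : ℝ} (h : Δ * ‖a - b‖ < ‖a‖ + ‖b‖) (hΔ : 1 ≤ Δ) (j : Fin d) :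
    |a j / ‖a‖ - b j / ‖b‖| ≤ 2 / Δ := by
  obtain ⟨ha, hb⟩ := ne_zero_of_mul_norm_sub_lt h hΔ
  have hA : 0 < ‖a‖ := norm_pos_iff.2 ha
  have hB : 0 < ‖b‖ := norm_pos_iff.2 hb
  have hΔ0 : 0 < Δ := by linarith
  have key := sum_sq_unit_sub ha hb
  set φ := ∑ j, (a j / ‖a‖ - b j / ‖b‖) ^ 2 with hφ
  have h1 : (a j / ‖a‖ - b j / ‖b‖) ^ 2 ≤ φ :=
    Finset.single_le_sum (f := fun j => (a j / ‖a‖ - b j / ‖b‖) ^ 2)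
      (fun _ _ => sq_nonneg _) (Finset.mem_univ j)
  have h2 : ‖a - b‖ ≤ ‖a‖ + ‖b‖ := norm_sub_le a b
  have h3 : ‖a - b‖ ^ 2 ≤ (‖a‖ + ‖b‖) ^ 2 := by gcongr
  -- Substitute `‖a‖ * ‖b‖ * φ = ‖a - b‖ ^ 2 - (‖a‖ - ‖b‖) ^ 2` and use `(‖a‖ + ‖b‖) ^ 2 - (‖a‖ -
  -- ‖b‖) ^ 2 = 4 * ‖a‖ * ‖b‖`.
  have h4 : (‖a‖ * ‖b‖) * (φ * (‖a‖ + ‖b‖) ^ 2) ≤ (‖a‖ * ‖b‖) * (4 * ‖a - b‖ ^ 2) := by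
    have := mul_le_mul_of_nonneg_left h3 (sq_nonneg (‖a‖ - ‖b‖))
    have e : ‖a‖ * ‖b‖ * φ = ‖a - b‖ ^ 2 - (‖a‖ - ‖b‖) ^ 2 := by linarith
    have e' : (‖a‖ * ‖b‖) * (φ * (‖a‖ + ‖b‖) ^ 2) =
      (‖a - b‖ ^ 2 - (‖a‖ - ‖b‖) ^ 2) * (‖a‖ + ‖b‖) ^ 2 := by rw [← e]; ring
    rw [e']
    nlinarith
  have h5 := le_of_mul_le_mul_left h4 (mul_pos hA hB)
  have h6 : Δ ^ 2 * ‖a - b‖ ^ 2 ≤ (‖a‖ + ‖b‖) ^ 2 := by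
    rw [← mul_pow]; gcongr
  have h7 : φ * Δ ^ 2 ≤ 4 := by
    have hs : 0 < (‖a‖ + ‖b‖) ^ 2 := by positivity
    refine le_of_mul_le_mul_right ?_ hs
    nlinarith [mul_le_mul_of_nonneg_left h5 (sq_nonneg Δ)]
  refine abs_le_of_sq_le_sq ?_ (by positivity : (0:ℝ) ≤ 2 / Δ)
  rw [div_pow, le_div_iff₀ (by positivity)]
  nlinarith [mul_le_mul_of_nonneg_right h1 (sq_nonneg Δ)]

/-- Write `p`, `q` for the norms and `φ` for the squared chord. The radial hypothesis yields `(Δ ^ 2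
- 1) * (q - p) ^ 2 ≤ p * q`, the angular one `Δ ^ 2 * φ < 3`. By the law of cosines `Δ ^ 2 * ‖a - b‖
^ 2` is then below `(q - p) ^ 2 + p * q + 3 * p * q = (p + q) ^ 2`. The norms enter squared because
a cell is cut into two rings, each with the square root of the full ratio. -/
theorem mul_norm_sub_lt_of_close {a b : EuclideanSpace ℝ (Fin d)} {Δ : ℝ} (ha : a ≠ 0) (hb : b ≠ 0) (hΔ : 1 ≤ Δ)
    (hab : ‖a‖ ≤ ‖b‖) (hr : (Δ - 1) * ‖b‖ ^ 2 ≤ (Δ + 1) * ‖a‖ ^ 2)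
    (hu : ∀ j, |a j / ‖a‖ - b j / ‖b‖| ≤ 2 / (Δ * (d + 1))) :
    Δ * ‖a - b‖ < ‖a‖ + ‖b‖ := by
  have hA : 0 < ‖a‖ := norm_pos_iff.2 ha
  have hB : 0 < ‖b‖ := norm_pos_iff.2 hb
  have hΔ0 : 0 < Δ := by linarith
  have key := sum_sq_unit_sub ha hb
  have hφ : ∑ j, (a j / ‖a‖ - b j / ‖b‖) ^ 2 ≤ d * (2 / (Δ * (d + 1))) ^ 2 := by
    have := Finset.sum_le_card_nsmul (Finset.univ : Finset (Fin d))
      (fun j => (a j / ‖a‖ - b j / ‖b‖) ^ 2) ((2 / (Δ * (d + 1))) ^ 2)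
      (fun j _ => by rw [← sq_abs]; gcongr; exact hu j)
    simpa using this
  set φ := ∑ j, (a j / ‖a‖ - b j / ‖b‖) ^ 2
  have h1 : Δ ^ 2 * φ < 3 := by
    have e : Δ ^ 2 * (d * (2 / (Δ * (d + 1))) ^ 2) = 4 * d / ((d:ℝ) + 1) ^ 2 := by
      field_simp
      ring
    have e' : 4 * d / ((d:ℝ) + 1) ^ 2 < 3 := by
      rw [div_lt_iff₀ (by positivity)]
      nlinarith [sq_nonneg ((d:ℝ) - 1), (Nat.cast_nonneg d : (0:ℝ) ≤ d)]
    have := mul_le_mul_of_nonneg_left hφ (sq_nonneg Δ)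
    linarith
  generalize ‖a‖ = p at *
  generalize ‖b‖ = q at *
  have h2 : (Δ ^ 2 - 1) * (q - p) ^ 2 ≤ p * q := by
    have s1 : Δ * (q ^ 2 - p ^ 2) ≤ q ^ 2 + p ^ 2 := by linarith
    have s2 : Δ ^ 2 * (q ^ 2 - p ^ 2) ^ 2 ≤ (q ^ 2 + p ^ 2) ^ 2 := by
      rw [← mul_pow]
      have : 0 ≤ q ^ 2 - p ^ 2 := by nlinarith
      gcongr
    have s3 : (Δ ^ 2 - 1) * (q - p) ^ 2 * (q + p) ^ 2 ≤ 4 * p ^ 2 * q ^ 2 := by nlinarith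
    have s4 : 4 * p ^ 2 * q ^ 2 ≤ p * q * (q + p) ^ 2 := by
      nlinarith [mul_nonneg (mul_pos hA hB).le (sq_nonneg (q - p))]
    exact le_of_mul_le_mul_right (s3.trans s4) (by positivity)
  have h3 : (Δ * ‖a - b‖) ^ 2 < (p + q) ^ 2 := by
    rw [mul_pow, key]
    nlinarith [mul_lt_mul_of_pos_left h1 (mul_pos hA hB)]
  exact lt_of_pow_lt_pow_left₀ 2 (by positivity) h3

theorem card_cell_le (S : Finset ℕ) (z : ℕ → EuclideanSpace ℝ (Fin d)) (side : ℕ → Prop) {Δ : ℝ} (hΔ : 1 ≤ Δ)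
    (hinj : ∀ p ∈ S, ∀ q ∈ S, z p = z q → p = q)
    (hsep : ∀ p ∈ S, ∀ q ∈ S, p ≠ q → (side p ↔ side q) → ‖z p‖ + ‖z q‖ ≤ Δ * ‖z p - z q‖)
    (hr : ∀ p ∈ S, ∀ q ∈ S, ‖z p‖ ≤ ‖z q‖ → (Δ - 1) * ‖z q‖ ≤ (Δ + 1) * ‖z p‖)
    (hu : ∀ p ∈ S, ∀ q ∈ S, ∀ j, |z p j / ‖z p‖ - z q j / ‖z q‖| ≤ 2 / Δ) :
    S.card ≤ 8 * (2 * d + 3) ^ d := by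
  classical
  rcases S.eq_empty_or_nonempty with rfl | hS
  · simp
  obtain ⟨m, hmS, hm⟩ := Finset.exists_min_image S (fun q => ‖z q‖) hS
  have hΔ0 : 0 < Δ := by linarith
  -- Boxes of side `2 / (Δ * (d + 1))` relative to the point `m` of least norm. By `hu` each index
  -- is between `-(d + 1)` and `d + 1`, which gives `2 * d + 3` values.
  set g : ℕ → Fin d → ℤ := fun q j =>
    ⌊(z q j / ‖z q‖ - z m j / ‖z m‖) * (Δ * (d + 1)) / 2⌋ with hg
  set T : Finset (Bool × Bool × Bool × (Fin d → ℤ)) :=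
    Finset.univ ×ˢ Finset.univ ×ˢ Finset.univ ×ˢ
      Fintype.piFinset (fun _ => Finset.Icc (-(d + 1 : ℤ)) (d + 1)) with hT
  have hTc : T.card = 8 * (2 * d + 3) ^ d := by
    simp only [hT, Finset.card_product, Fintype.card_piFinset, Int.card_Icc, Finset.card_univ,
      Fintype.card_bool, Finset.prod_const, Fintype.card_fin]
    rw [show ((d:ℤ) + 1 + 1 - -(d + 1)).toNat = 2 * d + 3 by omega]
    ring
  by_contra hlt
  rw [not_le, ← hTc] at hlt
  -- Pigeonhole on the side, on being the center, on the inner or outer ring, and on the box; the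
  -- three Booleans account for the factor `8`.
  obtain ⟨p, hp, q, hq, hne, heq⟩ := Finset.exists_ne_map_eq_of_card_lt_of_maps_to hlt
    (f := fun q => (decide (side q), decide (z q = 0),
      decide ((Δ - 1) * ‖z q‖ ^ 2 ≤ (Δ + 1) * ‖z m‖ ^ 2), g q))
    (by
      intro q hq
      simp only [hT, Finset.coe_product, Set.mem_prod, Finset.mem_coe, Finset.mem_univ, true_and,
        Fintype.mem_piFinset, Finset.mem_Icc]
      intro j
      have h := abs_le.1 (hu q hq m hmS j)
      have e : 2 / Δ * (Δ * (d + 1)) / 2 = (d + 1 : ℝ) := by field_simp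
      have hpos : 0 ≤ Δ * ((d : ℝ) + 1) := by positivity
      constructor
      · rw [Int.le_floor]
        push_cast
        have := mul_le_mul_of_nonneg_right h.1 hpos
        linarith
      · have h1 : ((g q j : ℤ) : ℝ) ≤ (d + 1 : ℝ) := by
          refine (Int.floor_le _).trans ?_
          have := mul_le_mul_of_nonneg_right h.2 hpos
          linarith
        exact_mod_cast h1)
  simp only [Prod.mk.injEq, decide_eq_decide] at heq
  obtain ⟨h1, h2, h3, h4⟩ := heq
  have hz : z p ≠ 0 := fun h => hne (hinj p hp q hq (by rw [h, h2.1 h]))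
  have main : ∀ p ∈ S, ∀ q ∈ S, p ≠ q → (side p ↔ side q) → z p ≠ 0 → z q ≠ 0 →
      ((Δ - 1) * ‖z p‖ ^ 2 ≤ (Δ + 1) * ‖z m‖ ^ 2 ↔ (Δ - 1) * ‖z q‖ ^ 2 ≤ (Δ + 1) * ‖z m‖ ^ 2) →
      g p = g q → ‖z p‖ ≤ ‖z q‖ → False := by
    intro p hp q hq hne h1 hzp hzq h3 h4 hpq
    refine absurd (hsep p hp q hq hne h1) (not_le.2 (mul_norm_sub_lt_of_close hzp hzq hΔ hpq ?_ ?_))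
    -- In the inner ring compare through `m` directly. In the outer ring square `hr` for `m` and
    -- `q`, and cancel `Δ - 1`, which is positive because the outer ring is not empty.
    · by_cases h : (Δ - 1) * ‖z q‖ ^ 2 ≤ (Δ + 1) * ‖z m‖ ^ 2
      · refine h.trans ?_
        have := hm p hp
        gcongr
      · have h' : (Δ + 1) * ‖z m‖ ^ 2 < (Δ - 1) * ‖z p‖ ^ 2 := not_le.1 (mt h3.1 h)
        have h5 := hr m hmS q hq (hm q hq)
        have h6 : 0 < Δ - 1 := by
          by_contra h6
          have : (Δ - 1) * ‖z p‖ ^ 2 ≤ 0 := mul_nonpos_of_nonpos_of_nonneg (by linarith) (sq_nonneg _)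
          have : 0 ≤ (Δ + 1) * ‖z m‖ ^ 2 := by positivity
          linarith
        have h7 : ((Δ - 1) * ‖z q‖) ^ 2 ≤ ((Δ + 1) * ‖z m‖) ^ 2 := by gcongr
        refine le_of_mul_le_mul_left ?_ h6
        nlinarith [mul_lt_mul_of_pos_left h' (by linarith : (0:ℝ) < Δ + 1)]
    · intro j
      have h5 := congrFun h4 j
      simp only [hg] at h5
      have h6 := (Int.abs_sub_lt_one_of_floor_eq_floor h5).le
      have e : (z p j / ‖z p‖ - z m j / ‖z m‖) * (Δ * (d + 1)) / 2 -
          (z q j / ‖z q‖ - z m j / ‖z m‖) * (Δ * (d + 1)) / 2 =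
          (z p j / ‖z p‖ - z q j / ‖z q‖) * (Δ * (d + 1)) / 2 := by ring
      rw [e, abs_div, abs_mul, abs_of_pos (by positivity : (0:ℝ) < Δ * (d + 1)),
        abs_of_pos (by norm_num : (0:ℝ) < 2), div_le_one (by norm_num)] at h6
      rwa [le_div_iff₀ (by positivity)]
  rcases le_total ‖z p‖ ‖z q‖ with h | h
  · exact main p hp q hq hne h1 hz (mt h2.2 hz) h3 h4 h
  · exact main q hq p hp hne.symm h1.symm (mt h2.2 hz) hz h3.symm h4.symm h

end Geometry

/-! ### Comparisons, and the table of queues. -/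

namespace RealRAM

/-- The sum of `k` real expressions. -/
def RExpr.sum (f : ℕ → RExpr) : ℕ → RExpr
  | 0 => .const 0
  | k + 1 => .add (RExpr.sum f k) (f k)

theorem RExpr.eval_sum (s : State) (f : ℕ → RExpr) (k : ℕ) :
    (RExpr.sum f k).eval s = ∑ j ∈ Finset.range k, (f j).eval s := by
  induction k with
  | zero => simp [RExpr.sum, RExpr.eval]
  | succ k ih => rw [RExpr.sum, RExpr.eval, ih, Finset.sum_range_succ]

/-- The sum of `k` expressions for natural numbers. -/
def NExpr.sum (f : ℕ → NExpr) : ℕ → NExpr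
  | 0 => .const 0
  | k + 1 => .add (NExpr.sum f k) (f k)

theorem NExpr.eval_sum (s : State) (f : ℕ → NExpr) (k : ℕ) :
    (NExpr.sum f k).eval s = ∑ j ∈ Finset.range k, (f j).eval s := by
  induction k with
  | zero => simp [NExpr.sum, NExpr.eval]
  | succ k ih => rw [NExpr.sum, NExpr.eval, ih, Finset.sum_range_succ]

theorem NExpr.eval_congr {s s' : State} (h : s'.nat = s.nat) (h' : s'.natArr = s.natArr)
    (e : NExpr) : e.eval s' = e.eval s := by
  induction e with
  | const => rfl
  | reg r => simp [NExpr.eval, h]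
  | load t i ih => simp [NExpr.eval, h', ih]
  | add e f ihe ihf => simp [NExpr.eval, ihe, ihf]
  | sub e f ihe ihf => simp [NExpr.eval, ihe, ihf]

/-- The real arrays `X` hold the coordinates of `n` distinct points, up to a translation, and the
norms and unit vectors of the translated points `z q`. -/
structure PointData (d n : ℕ) (X : ℕ → ℕ → ℝ) (z : ℕ → EuclideanSpace ℝ (Fin d)) : Prop where
  dist : ∀ p < n, ∀ q < n, √(∑ j ∈ Finset.range d, (X j p - X j q) * (X j p - X j q)) = ‖z p - z q‖
  norm : ∀ q < n, X d q = ‖z q‖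
  nonneg : ∀ q, 0 ≤ X d q
  unit : ∀ q < n, ∀ j : Fin d, X (d + (j + 1)) q = z q j / ‖z q‖
  inj : ∀ p < n, ∀ q < n, z p = z q → p = q

/-- The number `δ` is `1` or the dilation between two of the points. -/
def Attained {d : ℕ} (z : ℕ → EuclideanSpace ℝ (Fin d)) (n : ℕ) (δ : ℝ) : Prop :=
  δ = 1 ∨ ∃ p < n, ∃ q < n, p ≠ q ∧ δ = (‖z p‖ + ‖z q‖) / ‖z p - z q‖

/-- The point in slot `m` of the cell with address `a`. -/
def slot (a : NExpr) (m : ℕ) : NExpr := .load (4 * m + 2) a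

/-- Comparing the dilation between the current point and the one in slot `m` of the cell `a` with
the largest dilation found so far. -/
def check (d : ℕ) (a : NExpr) (m : ℕ) : Program :=
  .seq (.setReal 6 (.sqrt (RExpr.sum (fun j =>
      .mul (.sub (.load j (.reg 1)) (.load j (slot a m)))
        (.sub (.load j (.reg 1)) (.load j (slot a m)))) d)))
    (.ite (.and (.realLt (.const 0) (.reg 6)) (.realLt (.mul (.reg 0) (.reg 6))
        (.add (.load d (.reg 1)) (.load d (slot a m)))))
      (.setReal 0 (.div (.add (.load d (.reg 1)) (.load d (slot a m))) (.reg 6))) .skip)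

/-- The state `s'` differs from `s` by a larger dilation found, and by auxiliary real registers. -/
structure Improves {d : ℕ} (z : ℕ → EuclideanSpace ℝ (Fin d)) (n : ℕ) (s s' : State) : Prop where
  nat : s'.nat = s.nat
  natArr : s'.natArr = s.natArr
  realArr : s'.realArr = s.realArr
  le : s.real 0 ≤ s'.real 0
  attained : Attained z n (s.real 0) → Attained z n (s'.real 0)

section Lookup

variable {d n : ℕ} {X : ℕ → ℕ → ℝ} {z : ℕ → EuclideanSpace ℝ (Fin d)}

theorem Improves.refl (s : State) : Improves z n s s := ⟨rfl, rfl, rfl, le_rfl, id⟩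

theorem Improves.trans {s s' s'' : State} (h : Improves z n s s') (h' : Improves z n s' s'') :
    Improves z n s s'' :=
  ⟨h'.nat.trans h.nat, h'.natArr.trans h.natArr, h'.realArr.trans h.realArr, h.le.trans h'.le,
    h'.attained ∘ h.attained⟩

/-- A slot may hold the current point itself; the test that the distance is positive excludes this
case. -/
theorem check_run (hX : PointData d n X z) {s : State} (hs : s.realArr = X) {a : NExpr} {m p q : ℕ}
    (hp : s.nat 1 = p) (hpn : p < n) (hq : s.natArr (4 * m + 2) (a.eval s) = q) (hqn : q < n) :
    Improves z n s ((check d a m).run s) ∧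
      (p ≠ q → ‖z p‖ + ‖z q‖ ≤ ((check d a m).run s).real 0 * ‖z p - z q‖) := by
  have e1 : (slot a m).eval s = q := hq
  set s' := s.setReal 6 ‖z p - z q‖ with hs'
  have e2 : (slot a m).eval s' = q := by
    rw [NExpr.eval_congr (s := s) (by simp [hs']) (by simp [hs']), e1]
  have e3 : (check d a m).run s = (Program.ite (.and (.realLt (.const 0) (.reg 6))
      (.realLt (.mul (.reg 0) (.reg 6)) (.add (.load d (.reg 1)) (.load d (slot a m)))))
      (.setReal 0 (.div (.add (.load d (.reg 1)) (.load d (slot a m))) (.reg 6))) .skip).run s' := by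
    rw [check, Program.run_seq]
    congr 1
    simp only [Program.run, hs']
    congr 1
    simp only [RExpr.eval, RExpr.eval_sum, e1, NExpr.eval, hp, hs]
    exact hX.dist p hpn q hqn
  have f1 : s'.nat = s.nat := by simp [hs']
  have f2 : s'.real 0 = s.real 0 := by simp [hs']
  have f3 : s'.real 6 = ‖z p - z q‖ := by simp [hs']
  have f4 : s'.realArr = X := by simp [hs', hs]
  have f5 : s'.natArr = s.natArr := by simp [hs']
  by_cases hb : 0 < ‖z p - z q‖ ∧ s.real 0 * ‖z p - z q‖ < ‖z p‖ + ‖z q‖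
  · rw [e3, Program.run_ite_pos (by
      simpa [Test.Holds, RExpr.eval, NExpr.eval, e2, f1, f2, f3, f4, hp, hX.norm p hpn,
        hX.norm q hqn] using hb)]
    have hne : p ≠ q := by
      rintro rfl
      simp at hb
    simp only [Program.run, RExpr.eval, NExpr.eval, e2, f1, f3, f4, hp, hX.norm p hpn,
      hX.norm q hqn]
    refine ⟨⟨?_, ?_, ?_, ?_, fun _ => .inr ⟨p, hpn, q, hqn, hne, ?_⟩⟩, fun _ => ?_⟩
    · simp [f1]
    · simp [f5]
    · simp [f4, hs]
    · simp only [State.setReal_proj, Function.update_self]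
      rw [le_div_iff₀ hb.1]
      exact hb.2.le
    · simp
    · simp only [State.setReal_proj, Function.update_self]
      rw [div_mul_cancel₀ _ hb.1.ne']
  · rw [e3, Program.run_ite_neg (by
      simpa [Test.Holds, RExpr.eval, NExpr.eval, e2, f1, f2, f3, f4, hp, hX.norm p hpn,
        hX.norm q hqn] using hb)]
    refine ⟨⟨f1, f5, by rw [hs]; exact f4, f2.symm.le, fun h => ?_⟩, fun hne => ?_⟩
    · show Attained z n (s'.real 0)
      rwa [f2]
    · show _ ≤ s'.real 0 * _
      rw [f2]
      by_contra h
      exact hb ⟨norm_pos_iff.2 (sub_ne_zero.2 fun h => hne (hX.inj p hpn q hqn h)), not_le.1 h⟩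

/-- Checking the points in a list of slots. -/
def checkAll (d : ℕ) : List (NExpr × ℕ) → Program
  | [] => .skip
  | c :: L => .seq (check d c.1 c.2) (checkAll d L)

theorem checkAll_loopFree (d : ℕ) (L : List (NExpr × ℕ)) : (checkAll d L).LoopFree := by
  induction L with
  | nil => trivial
  | cons c L ih => exact ⟨by simp [check, Program.LoopFree], ih⟩

/-- The slots only have to hold valid point numbers: outdated entries and the initial zeros are
harmless. -/
theorem checkAll_run (hX : PointData d n X z) (L : List (NExpr × ℕ)) {s : State}
    (hs : s.realArr = X) {p : ℕ} (hp : s.nat 1 = p) (hpn : p < n)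
    (hslot : ∀ m a, s.natArr (4 * m + 2) a < n) :
    Improves z n s ((checkAll d L).run s) ∧
      ∀ c ∈ L, p ≠ (slot c.1 c.2).eval s → ‖z p‖ + ‖z ((slot c.1 c.2).eval s)‖ ≤
        ((checkAll d L).run s).real 0 * ‖z p - z ((slot c.1 c.2).eval s)‖ := by
  induction L generalizing s with
  | nil => exact ⟨.refl s, by simp⟩
  | cons c L ih =>
    obtain ⟨h1, h2⟩ := check_run hX hs (a := c.1) (m := c.2) hp hpn rfl (hslot _ _)
    obtain ⟨h3, h4⟩ := ih (s := (check d c.1 c.2).run s) (by rw [h1.realArr, hs])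
      (by rw [h1.nat, hp]) (by rw [h1.natArr]; exact hslot)
    refine ⟨h1.trans h3, fun c' hc' hne => ?_⟩
    rcases List.mem_cons.1 hc' with rfl | hc'
    · exact (h2 hne).trans (mul_le_mul_of_nonneg_right h3.le (norm_nonneg _))
    · have := h4 c' hc'
      rw [NExpr.eval_congr h1.nat h1.natArr] at this
      exact this hne

/-- Expressions for the addresses of the cells neighbouring the cell of the current point. -/
def neighbours : ℕ → List NExpr
  | 0 => [.reg 9]
  | k + 1 => (neighbours k).flatMap fun a =>
      [a, .add a (.reg (20 + k)), .add (.add a (.reg (20 + k))) (.reg (20 + k))]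

/-- Cell addresses have every digit raised by one while register `9` holds the unraised digits, so
the offsets `0`, `1`, `2` mean the preceding, the same and the following column. -/
theorem exists_mem_neighbours (e : ℕ → ℕ) (k : ℕ) (he : ∀ j < k, e j ≤ 2) :
    ∃ a ∈ neighbours k, ∀ s : State,
      a.eval s = s.nat 9 + ∑ j ∈ Finset.range k, e j * s.nat (20 + j) := by
  induction k with
  | zero => exact ⟨.reg 9, by simp [neighbours], by simp [NExpr.eval]⟩
  | succ k ih =>
    obtain ⟨a, ha, h⟩ := ih fun j hj => he j (by omega)
    have := he k (by omega)
    simp only [Finset.sum_range_succ, neighbours, List.mem_flatMap]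
    interval_cases hk : e k
    · exact ⟨a, ⟨a, ha, by simp⟩, fun s => by rw [h]; ring⟩
    · exact ⟨_, ⟨a, ha, .tail _ (.head _)⟩, fun s => by rw [NExpr.eval, h, NExpr.eval]; ring⟩
    · exact ⟨_, ⟨a, ha, .tail _ (.tail _ (.head _))⟩, fun s => by
        simp only [NExpr.eval, h]; ring⟩

/-- Inserting the current point into the queue with `k + 1` slots of the cell with the address in
register `9`. -/
def push : ℕ → Program
  | 0 => .storeNat 2 (.reg 9) (.reg 1)
  | k + 1 => .seq (.storeNat (4 * (k + 1) + 2) (.reg 9) (slot (.reg 9) k)) (push k)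

theorem push_loopFree (k : ℕ) : (push k).LoopFree := by
  induction k with
  | zero => trivial
  | succ k ih => exact ⟨trivial, ih⟩

/-- Copying starts at the oldest slot, so each entry is moved on before it is overwritten, and slot
`0` is left for the newest point. -/
theorem push_run (k : ℕ) (s : State) :
    ((push k).run s).nat = s.nat ∧ ((push k).run s).real = s.real ∧
    ((push k).run s).realArr = s.realArr ∧
    (∀ t, t % 4 ≠ 2 → ((push k).run s).natArr t = s.natArr t) ∧
    (∀ m a, a ≠ s.nat 9 → ((push k).run s).natArr (4 * m + 2) a = s.natArr (4 * m + 2) a) ∧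
    ((push k).run s).natArr 2 (s.nat 9) = s.nat 1 ∧
    (∀ m < k, ((push k).run s).natArr (4 * (m + 1) + 2) (s.nat 9) =
      s.natArr (4 * m + 2) (s.nat 9)) ∧
    (∀ m, k < m → ((push k).run s).natArr (4 * m + 2) (s.nat 9) =
      s.natArr (4 * m + 2) (s.nat 9)) := by
  induction k generalizing s with
  | zero =>
    simp only [push, Program.run, NExpr.eval, State.storeNat_proj, true_and]
    refine ⟨fun t ht => ?_, fun m a ha => ?_, ?_, by omega, fun m hm => ?_⟩
    · rw [Function.update_of_ne (by omega)]
    · by_cases hm : 4 * m + 2 = 2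
      · rw [hm, Function.update_self, Function.update_of_ne ha]
      · rw [Function.update_of_ne hm]
    · simp
    · rw [Function.update_of_ne (by omega)]
  | succ k ih =>
    rw [push, Program.run_seq]
    simp only [Program.run, NExpr.eval, slot]
    obtain ⟨h1, h2, h3, h4, h5, h6, h7, h8⟩ := ih
      (s.storeNat (4 * (k + 1) + 2) (s.nat 9) (s.natArr (4 * k + 2) (s.nat 9)))
    simp only [State.storeNat_proj] at *
    refine ⟨h1, h2, h3, fun t ht => ?_, fun m a ha => ?_, h6, fun m hm => ?_, fun m hm => ?_⟩
    · rw [h4 t ht, Function.update_of_ne (by omega)]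
    · rw [h5 m a ha]
      by_cases hm : 4 * m + 2 = 4 * (k + 1) + 2
      · rw [hm, Function.update_self, Function.update_of_ne ha]
      · rw [Function.update_of_ne hm]
    · rcases Nat.lt_succ_iff_lt_or_eq.1 hm with hlt | rfl
      · rw [h7 m hlt, Function.update_of_ne (by omega)]
      · rw [h8 _ (by omega), Function.update_self, Function.update_self]
    · rw [h8 m (by omega), Function.update_of_ne (by omega)]

/-- Visiting the current point: comparing it with the points in neighbouring cells and inserting it
into the queue of its cell. -/
def visit (d K : ℕ) : Program :=
  .seq (.setNat 9 (NExpr.sum (fun j => .load (4 * j + 1) (.reg 1)) (d + 1)))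
    (.seq (checkAll d ((neighbours (d + 1)).flatMap fun a => (List.range (K + 1)).map fun m => (a, m)))
      (.seq (.setNat 9 (.add (.reg 9) (NExpr.sum (fun j => .reg (20 + j)) (d + 1)))) (push K)))

/-- The invariant of the loop that visits all points. -/
structure VisitInv {d : ℕ} (z : ℕ → EuclideanSpace ℝ (Fin d)) (n w K : ℕ) (addr : ℕ → ℕ)
    (s₀ : State) (i : ℕ) (s : State) : Prop where
  nat : ∀ r, r ≠ 1 → r ≠ 9 → s.nat r = s₀.nat r
  natArr : ∀ t, t % 4 ≠ 2 → s.natArr t = s₀.natArr t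
  realArr : s.realArr = s₀.realArr
  slot_lt : ∀ m a, s.natArr (4 * m + 2) a < n
  le : s₀.real 0 ≤ s.real 0
  attained : Attained z n (s.real 0)
  queue : ∀ q < i, ∀ m ≤ K, ((Finset.Ioo q i).filter fun q' => addr q' = addr q).card = m →
    s.natArr (4 * m + 2) (addr q) = q
  found : ∀ q q', q < q' → q' < i → q' < q + w → ‖z q'‖ + ‖z q‖ ≤ s.real 0 * ‖z q' - z q‖

/-- A point sits in the slot whose number counts the later visitors of its cell. By `hcap` it has
not yet dropped out when a partner within the window arrives, and by `hnear` that partner inspects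
its cell if the pair matters. -/
theorem visit_run (hX : PointData d n X z) {s₀ : State} (hs : s₀.realArr = X) {w K : ℕ}
    {addr : ℕ → ℕ}
    (haddr : ∀ q < n, addr q = ∑ j ∈ Finset.range (d + 1), s₀.natArr (4 * j + 1) q +
      ∑ j ∈ Finset.range (d + 1), s₀.nat (20 + j))
    (hcap : ∀ i < n, ∀ q < i, i < q + w →
      ((Finset.Ioo q i).filter fun q' => addr q' = addr q).card ≤ K)
    (hnear : ∀ p < n, ∀ q < n, s₀.real 0 * ‖z p - z q‖ < ‖z p‖ + ‖z q‖ →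
      ∃ e : ℕ → ℕ, (∀ j < d + 1, e j ≤ 2) ∧ ∑ j ∈ Finset.range (d + 1), s₀.natArr (4 * j + 1) p +
        ∑ j ∈ Finset.range (d + 1), e j * s₀.nat (20 + j) = addr q)
    {i : ℕ} (hi : i < n) {s : State} (h1 : s.nat 1 = i) (h : VisitInv z n w K addr s₀ i s) :
    ((visit d K).run s).nat 1 = i ∧ VisitInv z n w K addr s₀ (i + 1) ((visit d K).run s) := by
  set key := ∑ j ∈ Finset.range (d + 1), s₀.natArr (4 * j + 1) i with hkey
  set L : List (NExpr × ℕ) := (neighbours (d + 1)).flatMap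
    fun a => (List.range (K + 1)).map fun m => (a, m) with hL
  set s₁ := s.setNat 9 key with hs₁
  set s₂ := (checkAll d L).run s₁ with hs₂
  set s₃ := s₂.setNat 9 (addr i) with hs₃
  have g1 : s₁.nat 1 = i := by simp [hs₁, h1]
  obtain ⟨c1, c2⟩ := checkAll_run hX L (s := s₁) (by simp [hs₁, h.realArr, hs]) g1 hi
    (by simpa [hs₁] using h.slot_lt)
  rw [← hs₂] at c1 c2
  have e : (visit d K).run s = (push K).run s₃ := by
    rw [visit, Program.run_seq, Program.run_seq, Program.run_seq]
    congr 1
    have e1 : (Program.setNat 9 (NExpr.sum (fun j => .load (4 * j + 1) (.reg 1)) (d + 1))).run s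
        = s₁ := by
      simp only [Program.run, NExpr.eval_sum, NExpr.eval, h1, hs₁, hkey]
      congr 1
      exact Finset.sum_congr rfl fun j _ => by rw [h.natArr _ (by omega)]
    rw [e1, ← hs₂]
    simp only [Program.run, NExpr.eval_sum, NExpr.eval, hs₃]
    congr 1
    rw [haddr i hi, c1.nat]
    simp only [hs₁, State.setNat_proj, Function.update_self, hkey]
    congr 1
    refine Finset.sum_congr rfl fun j _ => ?_
    rw [Function.update_of_ne (by omega), h.nat _ (by omega) (by omega)]
  obtain ⟨p1, p2, p3, p4, p5, p6, p7, p8⟩ := push_run K s₃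
  have t1 : s₃.nat 1 = i := by simp [hs₃, c1.nat, g1]
  have t2 : s₃.natArr = s.natArr := by simp [hs₃, c1.natArr, hs₁]
  have t3 : s₃.nat 9 = addr i := by simp [hs₃]
  have t4 : s₃.real = s₂.real := by simp [hs₃]
  rw [t3] at p5 p6 p7 p8
  rw [t2] at p4 p5 p7 p8
  rw [t1] at p6
  rw [e]
  have hle : s.real 0 ≤ s₂.real 0 := by simpa [hs₁] using c1.le
  refine ⟨by rw [p1, t1], ?_⟩
  exact
  { nat := by
      intro r hr hr'
      rw [p1, ← h.nat r hr hr']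
      simp [hs₃, c1.nat, hs₁, hr']
    natArr := fun t ht => by rw [p4 t ht, h.natArr t ht]
    realArr := by
      rw [p3, ← h.realArr]
      simp [hs₃, c1.realArr, hs₁]
    slot_lt := by
      intro m a
      by_cases ha : a = addr i
      · subst ha
        rcases lt_trichotomy m (K + 1) with hm | hm | hm
        · rcases m with _ | m
          · rw [p6]; exact hi
          · rw [p7 m (by omega)]; exact h.slot_lt _ _
        · rw [p8 m (by omega)]; exact h.slot_lt _ _
        · rw [p8 m (by omega)]; exact h.slot_lt _ _
      · rw [p5 m a ha]; exact h.slot_lt _ _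
    le := by rw [p2, t4]; exact h.le.trans hle
    attained := by rw [p2, t4]; exact c1.attained (by simpa [hs₁] using h.attained)
    queue := by
      intro q hq m hm hcard
      rcases Nat.lt_succ_iff_lt_or_eq.1 hq with hlt | rfl
      · have hins : Finset.Ioo q (i + 1) = insert i (Finset.Ioo q i) := by
          ext x; simp only [Finset.mem_Ioo, Finset.mem_insert]; omega
        rw [hins, Finset.filter_insert] at hcard
        by_cases ha : addr i = addr q
        · rw [if_pos ha, Finset.card_insert_of_notMem (by simp)] at hcard
          subst hcard
          have := p7 _ (Nat.lt_of_succ_le hm)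
          rw [ha] at this
          rw [this]
          exact h.queue q hlt _ (by omega) rfl
        · rw [if_neg ha] at hcard
          rw [p5 m _ (fun h => ha h.symm)]
          exact h.queue q hlt m hm hcard
      · have : Finset.Ioo q (q + 1) = ∅ := by ext x; simp
        rw [this] at hcard
        simp only [Finset.filter_empty, Finset.card_empty] at hcard
        rw [← hcard]
        exact p6
    found := by
      intro q q' hqq' hq' hw
      rw [p2, t4]
      rcases Nat.lt_succ_iff_lt_or_eq.1 hq' with hlt | rfl
      · exact (h.found q q' hqq' hlt hw).trans (mul_le_mul_of_nonneg_right hle (norm_nonneg _))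
      -- The threshold is the value at the start of the pass, which also determined the cells; pairs
      -- not above it are already accounted for, as the register only grows.
      · by_cases hn : s₀.real 0 * ‖z q' - z q‖ < ‖z q'‖ + ‖z q‖
        · obtain ⟨e, he, hsum⟩ := hnear q' hi q (hqq'.trans hi) hn
          obtain ⟨a, ha, hae⟩ := exists_mem_neighbours e (d + 1) he
          have hcq := hcap q' hi q hqq' hw
          have ha' : a.eval s₁ = addr q := by
            rw [hae, ← hsum]
            simp only [hs₁, State.setNat_proj, Function.update_self, hkey]
            congr 1
            refine Finset.sum_congr rfl fun j _ => ?_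
            rw [Function.update_of_ne (by omega), h.nat _ (by omega) (by omega)]
          set m := ((Finset.Ioo q q').filter fun q'' => addr q'' = addr q).card with hm
          have hsl : (slot a m).eval s₁ = q := by
            rw [slot, NExpr.eval, ha']
            simpa [hs₁] using h.queue q hqq' m hcq hm.symm
          have := c2 (a, m) (by
            rw [hL, List.mem_flatMap]
            exact ⟨a, ha, List.mem_map.2 ⟨m, by simpa [Nat.lt_succ_iff] using hcq, rfl⟩⟩)
          simp only [hsl] at this
          exact this (by omega)
        · exact (not_lt.1 hn).trans
            (mul_le_mul_of_nonneg_right (h.le.trans hle) (norm_nonneg _)) }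

end Lookup

/-! ### Cell addresses in mixed radix. -/

theorem sum_mixedRadix_lt {W M a : ℕ → ℕ} {k : ℕ} (h0 : W 0 = 1)
    (hW : ∀ j < k, W (j + 1) = (M j + 3) * W j) (ha : ∀ j < k, a j ≤ M j + 2) :
    ∑ j ∈ Finset.range k, a j * W j < W k := by
  induction k with
  | zero => simp [h0]
  | succ k ih =>
    have h1 := ih (fun j hj => hW j (by omega)) (fun j hj => ha j (by omega))
    have h2 := Nat.mul_le_mul_right (W k) (ha k (by omega))
    rw [Finset.sum_range_succ, hW k (by omega)]
    linarith

theorem mixedRadix_injective {W M a b : ℕ → ℕ} {k : ℕ} (h0 : W 0 = 1)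
    (hW : ∀ j < k, W (j + 1) = (M j + 3) * W j) (ha : ∀ j < k, a j ≤ M j + 2)
    (hb : ∀ j < k, b j ≤ M j + 2)
    (h : ∑ j ∈ Finset.range k, a j * W j = ∑ j ∈ Finset.range k, b j * W j) :
    ∀ j < k, a j = b j := by
  induction k with
  | zero => simp
  | succ k ih =>
    have h1 := sum_mixedRadix_lt h0 (fun j hj => hW j (by omega)) (k := k)
      (fun j hj => ha j (by omega))
    have h2 := sum_mixedRadix_lt h0 (fun j hj => hW j (by omega)) (k := k)
      (fun j hj => hb j (by omega))
    rw [Finset.sum_range_succ, Finset.sum_range_succ] at h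
    have hk : a k = b k := by
      rcases lt_trichotomy (a k) (b k) with hlt | heq | hlt
      · have := Nat.mul_le_mul_right (W k) hlt
        rw [Nat.succ_mul] at this
        omega
      · exact heq
      · have := Nat.mul_le_mul_right (W k) hlt
        rw [Nat.succ_mul] at this
        omega
    intro j hj
    rcases Nat.lt_succ_iff_lt_or_eq.1 hj with hj | rfl
    · exact ih (fun j hj => hW j (by omega)) (fun j hj => ha j (by omega))
        (fun j hj => hb j (by omega)) (by rw [hk] at h; omega) j hj
    · exact hk

/-! ### The grid of cells and one pass of the main loop. -/

/-- The coefficients of the column tests: the columns of the norm are multiplicative, those of the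
coordinates of the unit vectors are additive. -/
noncomputable def coeffs (δ : ℝ) : ℕ → ℝ × ℝ × ℝ
  | 0 => (δ + 1, 0, δ - 1)
  | _ + 1 => (1, 2 / δ, 1)

/-- Expressions for the coefficients of the column tests. -/
def coeffExprs : ℕ → RExpr × RExpr × RExpr
  | 0 => (.add (.reg 0) (.const 1), .const 0, .sub (.reg 0) (.const 1))
  | _ + 1 => (.const 1, .div (.const 2) (.reg 0), .const 1)

/-- The first `k` of the sweeps that divide the points into cells. -/
def grid (d : ℕ) : ℕ → Program
  | 0 => .setNat 20 (.const 1)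
  | k + 1 => .seq (grid d k) (sweep (coeffExprs k).1 (coeffExprs k).2.1 (coeffExprs k).2.2
      (d + k) (4 * k) (4 * k + 1) (20 + k))

/-- The state after `k` sweeps. -/
structure GridInv (d n : ℕ) (s₀ : State) (k : ℕ) (s : State) : Prop where
  nat : ∀ r < 20, r ≠ 1 → r ≠ 7 → s.nat r = s₀.nat r
  real : s.real 0 = s₀.real 0
  natArr : ∀ t, t % 4 ≠ 1 → s.natArr t = s₀.natArr t
  realArr : s.realArr = s₀.realArr
  weight : s.nat 20 = 1
  cols : ∀ j < k, ∃ col M, Columns (coeffs (s₀.real 0) j).1 (coeffs (s₀.real 0) j).2.1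
    (coeffs (s₀.real 0) j).2.2 (s₀.realArr (d + j)) n col M ∧
    (∀ q < n, s.natArr (4 * j + 1) q = col q * s.nat (20 + j)) ∧
    s.nat (20 + j + 1) = (M + 3) * s.nat (20 + j)

section Level

variable {d n : ℕ} {X : ℕ → ℕ → ℝ} {z : ℕ → EuclideanSpace ℝ (Fin d)}

theorem grid_spec (hX : PointData d n X z) (s₀ : State) (hs : s₀.realArr = X) (h0 : s₀.nat 0 = n)
    (hδ : 1 ≤ s₀.real 0) (hsort : ∀ j < d + 1, SortedBy (X (d + j)) (s₀.natArr (4 * j)) n)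
    (k : ℕ) (hk : k ≤ d + 1) :
    Spec (fun s => s = s₀) (grid d k) (GridInv d n s₀ k) (100 * (n + 1) * (k + 1)) := by
  induction k with
  | zero =>
    refine (Spec.of_run (p := .setNat 20 (.const 1)) trivial ?_).mono (fun s h => h) (fun s h => h)
      (by simp only [Program.bound, NExpr.cost]; omega)
    rintro s rfl
    refine ⟨fun r hr _ _ => ?_, rfl, fun _ _ => rfl, rfl, ?_, by omega⟩
    · simp [Program.run, show r ≠ 20 by omega]
    · simp [Program.run, NExpr.eval]
  | succ k ih =>
    rintro s rfl
    obtain ⟨s', l, hl, hg, hlb⟩ := ih (by omega) s rfl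
    have hreal : ∀ s'' : State, s''.real 0 = s'.real 0 → s''.real 0 = s.real 0 :=
      fun s'' h => h.trans hg.real
    have hS := sweep_spec s' (coeffExprs k).1 (coeffExprs k).2.1 (coeffExprs k).2.2
      (coeffs (s.real 0) k).1 (coeffs (s.real 0) k).2.1 (coeffs (s.real 0) k).2.2
      (d + k) (4 * k) (4 * k + 1) (20 + k) n (by omega) (by omega)
      (by rw [hg.nat 0 (by omega) (by omega) (by omega), h0])
      (by rcases k with _ | k <;> intro s'' h <;> simp [coeffExprs, coeffs, RExpr.eval, hreal s'' h])
      (by rcases k with _ | k <;> intro s'' h <;> simp [coeffExprs, coeffs, RExpr.eval, hreal s'' h])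
      (by rcases k with _ | k <;> intro s'' h <;> simp [coeffExprs, coeffs, RExpr.eval, hreal s'' h])
      (by rcases k with _ | k <;> simp only [coeffs] <;> linarith)
      (by rcases k with _ | k <;> simp only [coeffs] <;> linarith)
      (by
        intro q
        rw [hg.realArr, hs]
        rcases k with _ | k
        · simp only [coeffs, add_zero]
          have := hX.nonneg q
          nlinarith
        · simp only [coeffs]
          have : 0 < 2 / s.real 0 := by positivity
          linarith)
      (by rw [hg.realArr, hg.natArr _ (by omega), hs]; exact hsort k (by omega))
    obtain ⟨s'', l', hl', ⟨hf, col, M, hc, hcq, hM⟩, hlb'⟩ := hS s' rfl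
    refine ⟨s'', _, .seq hl hl', ⟨?_, ?_, ?_, ?_, ?_, ?_⟩, ?_⟩
    · intro r hr h1 h7
      rw [hf.nat r h1 h7 (by omega), hg.nat r hr h1 h7]
    · rw [hf.real, hg.real]
    · intro t ht
      rw [hf.natArr t (by omega), hg.natArr t ht]
    · rw [hf.realArr, hg.realArr]
    · rw [hf.nat 20 (by omega) (by omega) (by omega), hg.weight]
    · intro j hj
      have e : s''.nat (20 + j) = s'.nat (20 + j) := hf.nat _ (by omega) (by omega) (by omega)
      rcases Nat.lt_succ_iff_lt_or_eq.1 hj with hj | rfl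
      · obtain ⟨col, M, hc, hcq, hM⟩ := hg.cols j hj
        refine ⟨col, M, hc, fun q hq => ?_, ?_⟩
        · rw [hf.natArr _ (by omega), e, hcq q hq]
        · rw [hf.nat _ (by omega) (by omega) (by omega), e, hM]
      · rw [hg.realArr] at hc
        exact ⟨col, M, hc, fun q hq => by rw [e, hcq q hq], by rw [hM, e]⟩
    · have : (coeffExprs k).1.cost + (coeffExprs k).2.1.cost + (coeffExprs k).2.2.cost ≤ 40 := by
        rcases k with _ | k <;> simp [coeffExprs, RExpr.cost]
      have := Nat.mul_le_mul_right (n + 1) (Nat.add_le_add_right this 60)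
      linarith

/-- The invariant of the main loop: the points whose numbers differ by less than `w` have been
compared. -/
structure LevelInv {d : ℕ} (z : ℕ → EuclideanSpace ℝ (Fin d)) (n : ℕ) (X : ℕ → ℕ → ℝ) (w : ℕ)
    (s : State) : Prop where
  realArr : s.realArr = X
  sorted : ∀ j < d + 1, SortedBy (X (d + j)) (s.natArr (4 * j)) n
  slot_lt : ∀ m a, s.natArr (4 * m + 2) a < n
  one_le : 1 ≤ s.real 0
  attained : Attained z n (s.real 0)
  found : ∀ q q', q < q' → q' < n → q' < q + w → ‖z q'‖ + ‖z q‖ ≤ s.real 0 * ‖z q' - z q‖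

/-- One pass of the main loop. -/
def level (d : ℕ) : Program :=
  .seq (grid d (d + 1)) (forLoop (visit d (8 * (2 * d + 3) ^ d)))

theorem visit_loopFree (d K : ℕ) : (visit d K).LoopFree :=
  ⟨trivial, checkAll_loopFree _ _, trivial, push_loopFree _⟩

theorem sum_norm_le_of_found {s : State} {w : ℕ} (h : LevelInv z n X w s) {p q : ℕ} (hp : p < n)
    (hq : q < n) (hne : p ≠ q) (h1 : p < q + w) (h2 : q < p + w) :
    ‖z p‖ + ‖z q‖ ≤ s.real 0 * ‖z p - z q‖ := by
  rcases lt_or_gt_of_ne hne with hlt | hlt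
  · rw [add_comm, norm_sub_rev]
    exact h.found p q hlt hq h2
  · exact h.found q p hlt hp h1

theorem exists_cells (hX : PointData d n X z) {s₀ s : State} {w : ℕ} (hL : LevelInv z n X w s₀)
    (hg : GridInv d n s₀ (d + 1) s) :
    ∃ addr : ℕ → ℕ,
    (∀ q < n, addr q = ∑ j ∈ Finset.range (d + 1), s.natArr (4 * j + 1) q +
      ∑ j ∈ Finset.range (d + 1), s.nat (20 + j)) ∧
    (∀ i < n, ∀ q < i, i < q + 2 * w →
      ((Finset.Ioo q i).filter fun q' => addr q' = addr q).card ≤ 8 * (2 * d + 3) ^ d) ∧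
    (∀ p < n, ∀ q < n, s.real 0 * ‖z p - z q‖ < ‖z p‖ + ‖z q‖ →
      ∃ e : ℕ → ℕ, (∀ j < d + 1, e j ≤ 2) ∧ ∑ j ∈ Finset.range (d + 1), s.natArr (4 * j + 1) p +
        ∑ j ∈ Finset.range (d + 1), e j * s.nat (20 + j) = addr q) := by
  have hcols : ∀ j, ∃ col M, j < d + 1 → Columns (coeffs (s₀.real 0) j).1 (coeffs (s₀.real 0) j).2.1
      (coeffs (s₀.real 0) j).2.2 (X (d + j)) n col M ∧
      (∀ q < n, s.natArr (4 * j + 1) q = col q * s.nat (20 + j)) ∧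
      s.nat (20 + (j + 1)) = (M + 3) * s.nat (20 + j) := by
    intro j
    by_cases hj : j < d + 1
    · obtain ⟨col, M, h⟩ := hg.cols j hj
      rw [hL.realArr] at h
      exact ⟨col, M, fun _ => h⟩
    · exact ⟨fun _ => 0, 0, fun h => absurd h hj⟩
  choose col M hcols using hcols
  set δ := s₀.real 0 with hδ
  have hδ1 : 1 ≤ δ := hL.one_le
  have hδ0 : 0 < δ := by linarith
  set W : ℕ → ℕ := fun j => s.nat (20 + j) with hW
  have hsum : ∀ q < n, ∑ j ∈ Finset.range (d + 1), s.natArr (4 * j + 1) q =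
      ∑ j ∈ Finset.range (d + 1), col j q * W j := fun q hq =>
    Finset.sum_congr rfl fun j hj => (hcols j (Finset.mem_range.1 hj)).2.1 q hq
  -- Raising the digits by one keeps the column before the first from becoming negative.
  refine ⟨fun q => ∑ j ∈ Finset.range (d + 1), (col j q + 1) * W j, ?_, ?_, ?_⟩
  · intro q hq
    rw [hsum q hq, ← Finset.sum_add_distrib]
    exact Finset.sum_congr rfl fun j _ => by ring
  · intro i hi q hq hw
    have hmem : ∀ p ∈ (Finset.Ioo q i).filter fun q' =>
        ∑ j ∈ Finset.range (d + 1), (col j q' + 1) * W j =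
        ∑ j ∈ Finset.range (d + 1), (col j q + 1) * W j,
        q < p ∧ p < i ∧ ∀ j < d + 1, col j p = col j q := by
      intro p hp
      rw [Finset.mem_filter, Finset.mem_Ioo] at hp
      refine ⟨hp.1.1, hp.1.2, fun j hj => ?_⟩
      have := mixedRadix_injective (W := W) (M := M) (k := d + 1) (a := fun j => col j p + 1)
        (b := fun j => col j q + 1) hg.weight
        (fun j hj => (hcols j hj).2.2) (fun j hj => by
          have := (hcols j hj).1.le p (hp.1.2.trans hi); omega) (fun j hj => by
          have := (hcols j hj).1.le q (hq.trans hi); omega) hp.2 j hj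
      simpa using this
    -- The window of length `2 * w` is cut at `q + w`; indices on the same side differ by less than
    -- `w`, so their pairs have been compared before.
    refine card_cell_le _ z (fun q' => q' < q + w) hδ1 ?_ ?_ ?_ ?_
    · intro p hp p' hp'
      exact hX.inj p (by have := hmem p hp; omega) p' (by have := hmem p' hp'; omega)
    · intro p hp p' hp' hne hside
      have h1 := hmem p hp
      have h2 := hmem p' hp'
      exact sum_norm_le_of_found hL (by omega) (by omega) hne (by omega) (by omega)
    · intro p hp p' hp' hle
      have h1 := hmem p hp
      have h2 := hmem p' hp'
      have := (hcols 0 (by omega)).1.same p (by omega) p' (by omega)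
        ((h1.2.2 0 (by omega)).trans (h2.2.2 0 (by omega)).symm)
      simp only [coeffs, add_zero, hX.norm p (by omega), hX.norm p' (by omega)] at this
      exact not_lt.1 (this hle)
    · have key : ∀ p < n, ∀ p' < n, (∀ j < d + 1, col j p = col j p') → ∀ j : Fin d,
          z p' j / ‖z p'‖ - z p j / ‖z p‖ ≤ 2 / δ := by
        intro p hp p' hp' h j
        have := (hcols (j + 1) (by omega)).1.same p hp p' hp' (h _ (by omega))
        simp only [coeffs, hX.unit p hp, hX.unit p' hp', one_mul] at this
        rcases le_total (z p j / ‖z p‖) (z p' j / ‖z p'‖) with hle | hle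
        · linarith [not_lt.1 (this hle)]
        · have : 0 < 2 / δ := by positivity
          linarith
      intro p hp p' hp' j
      have h1 := hmem p hp
      have h2 := hmem p' hp'
      rw [abs_le]
      constructor
      · have := key p (by omega) p' (by omega)
          (fun j hj => (h1.2.2 j hj).trans (h2.2.2 j hj).symm) j
        linarith
      · exact key p' (by omega) p (by omega)
          (fun j hj => (h2.2.2 j hj).trans (h1.2.2 j hj).symm) j
  · intro p hp q hq hlt
    rw [hg.real, ← hδ] at hlt
    have hlt' : δ * ‖z q - z p‖ < ‖z q‖ + ‖z p‖ := by rwa [norm_sub_rev, add_comm]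
    have hnear : ∀ j < d + 1, col j p ≤ col j q + 1 ∧ col j q ≤ col j p + 1 := by
      intro j hj
      have hn := (hcols j hj).1.near
      rcases le_total (X (d + j) p) (X (d + j) q) with hle | hle
      · refine hn p hp q hq hle ?_
        rcases j with _ | j
        · simp only [coeffs, add_zero, hX.norm p hp, hX.norm q hq]
          exact not_lt_of_mul_norm_sub_lt hlt hδ1
        · have := abs_le.1 (abs_unit_sub_le_of_mul_norm_sub_lt hlt hδ1 ⟨j, by omega⟩)
          have e1 := hX.unit p hp ⟨j, by omega⟩
          have e2 := hX.unit q hq ⟨j, by omega⟩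
          simp only at e1 e2
          simp only [coeffs, e1, e2]
          linarith
      · refine (hn q hq p hp hle ?_).symm
        rcases j with _ | j
        · simp only [coeffs, add_zero, hX.norm p hp, hX.norm q hq]
          exact not_lt_of_mul_norm_sub_lt hlt' hδ1
        · have := abs_le.1 (abs_unit_sub_le_of_mul_norm_sub_lt hlt hδ1 ⟨j, by omega⟩)
          have e1 := hX.unit p hp ⟨j, by omega⟩
          have e2 := hX.unit q hq ⟨j, by omega⟩
          simp only at e1 e2
          simp only [coeffs, e1, e2]
          linarith
    -- Nothing is truncated here, since neighbouring columns satisfy `col j p ≤ col j q + 1`.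
    refine ⟨fun j => col j q + 1 - col j p, fun j hj => ?_, ?_⟩
    · have := hnear j hj
      simp only
      omega
    · rw [hsum p hp, ← Finset.sum_add_distrib]
      refine Finset.sum_congr rfl fun j hj => ?_
      rw [← add_mul]
      congr 1
      have := hnear j (Finset.mem_range.1 hj)
      simp only
      omega

theorem level_spec (hX : PointData d n X z) (w : ℕ) :
    Spec (fun s => s.nat 0 = n ∧ s.nat 2 = w ∧ LevelInv z n X w s) (level d)
      (fun s => s.nat 0 = n ∧ s.nat 2 = w ∧ LevelInv z n X (2 * w) s)
      (100 * (n + 1) * (d + 2) + ((visit d (8 * (2 * d + 3) ^ d)).bound + 10) * (n + 1)) := by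
  rintro s₀ ⟨h0, h2, hL⟩
  obtain ⟨s, k, hk, hg, hkb⟩ := grid_spec hX s₀ hL.realArr h0 hL.one_le hL.sorted (d + 1) le_rfl s₀ rfl
  obtain ⟨addr, ha, hcap, hnear⟩ := exists_cells hX hL hg
  have hV := Spec.forLoop (visit_loopFree d (8 * (2 * d + 3) ^ d)) n
    (VisitInv z n (2 * w) (8 * (2 * d + 3) ^ d) addr s)
    (by
      intro i s' h m
      refine ⟨fun r h1 h9 => ?_, h.natArr, h.realArr, h.slot_lt, h.le, h.attained, h.queue, h.found⟩
      simpa [h1] using h.nat r h1 h9)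
    (by
      intro i s' hi h0 h1 h
      obtain ⟨e1, e⟩ := visit_run hX (by rw [hg.realArr, hL.realArr]) ha hcap hnear hi h1 h
      refine ⟨?_, e1, e⟩
      rw [e.nat 0 (by omega) (by omega), ← h.nat 0 (by omega) (by omega), h0])
  obtain ⟨s', l, hl, ⟨g0, hs'⟩, hlb⟩ := hV s ⟨by rw [hg.nat 0 (by omega) (by omega) (by omega), h0],
    fun _ _ _ => rfl, fun _ _ => rfl, rfl,
    fun m a => by rw [hg.natArr _ (by omega)]; exact hL.slot_lt m a, le_rfl,
    by rw [hg.real]; exact hL.attained, by omega, by omega⟩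
  refine ⟨s', _, .seq hk hl, ⟨g0, ?_, ?_⟩, by linarith⟩
  · rw [hs'.nat 2 (by omega) (by omega), hg.nat 2 (by omega) (by omega) (by omega), h2]
  · exact
    { realArr := by rw [hs'.realArr, hg.realArr, hL.realArr]
      sorted := fun j hj => by
        rw [hs'.natArr _ (by omega), hg.natArr _ (by omega)]; exact hL.sorted j hj
      slot_lt := hs'.slot_lt
      one_le := hL.one_le.trans (by rw [← hg.real]; exact hs'.le)
      attained := hs'.attained
      found := hs'.found }

end Level

/-! ### Norms and unit vectors of the translated points. -/

/-- Computing the first `k` coordinates of the unit vector of the current point. -/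
def unitCoords (d : ℕ) : ℕ → Program
  | 0 => .skip
  | k + 1 => .seq (unitCoords d k) (.storeReal (d + (k + 1)) (.reg 1)
      (.div (.sub (.load k (.reg 1)) (.reg k)) (.load d (.reg 1))))

theorem unitCoords_loopFree (d k : ℕ) : (unitCoords d k).LoopFree := by
  induction k with
  | zero => trivial
  | succ k ih => exact ⟨ih, trivial⟩

theorem unitCoords_run (d k : ℕ) (hk : k ≤ d) (s : State) :
    ((unitCoords d k).run s).nat = s.nat ∧ ((unitCoords d k).run s).natArr = s.natArr ∧
    ((unitCoords d k).run s).real = s.real ∧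
    (∀ t ≤ d, ((unitCoords d k).run s).realArr t = s.realArr t) ∧
    (∀ t i, i ≠ s.nat 1 → ((unitCoords d k).run s).realArr t i = s.realArr t i) ∧
    ∀ j < k, ((unitCoords d k).run s).realArr (d + (j + 1)) (s.nat 1) =
      (s.realArr j (s.nat 1) - s.real j) / s.realArr d (s.nat 1) := by
  induction k with
  | zero => simp [unitCoords, Program.run]
  | succ k ih =>
    obtain ⟨h1, h2, h3, h4, h5, h6⟩ := ih (by omega)
    rw [unitCoords, Program.run_seq]
    simp only [Program.run, RExpr.eval, NExpr.eval, State.storeReal_proj, h1, h3, h4 d le_rfl,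
      h4 k (by omega)]
    refine ⟨trivial, h2, trivial, fun t ht => ?_, fun t i hi => ?_, fun j hj => ?_⟩
    · rw [Function.update_of_ne (by omega), h4 t ht]
    · by_cases ht : t = d + (k + 1)
      · rw [ht, Function.update_self, Function.update_of_ne hi, h5 _ i hi]
      · rw [Function.update_of_ne ht, h5 t i hi]
    · rcases Nat.lt_succ_iff_lt_or_eq.1 hj with hj | rfl
      · rw [Function.update_of_ne (by omega), h6 j hj]
      · rw [Function.update_self, Function.update_self]

/-- Computing the norm and the unit vector of the current point, relative to the center. -/
def prepareStep (d : ℕ) : Program :=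
  .seq (.storeReal d (.reg 1) (.sqrt (RExpr.sum (fun j =>
      .mul (.sub (.load j (.reg 1)) (.reg j)) (.sub (.load j (.reg 1)) (.reg j))) d)))
    (unitCoords d d)

/-- The point number `q` relative to the center. -/
noncomputable def relPoint {d n : ℕ} (v : Fin n → EuclideanSpace ℝ (Fin d))
    (c : EuclideanSpace ℝ (Fin d)) (q : ℕ) : EuclideanSpace ℝ (Fin d) :=
  if h : q < n then v ⟨q, h⟩ - c else 0

section Prepare

variable {d n : ℕ} (v : Fin n → EuclideanSpace ℝ (Fin d)) (c : EuclideanSpace ℝ (Fin d))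

theorem starInput_realArr {q : ℕ} (hq : q < n) (j : Fin d) :
    (starInput v c).realArr j q = v ⟨q, hq⟩ j := by
  simp [starInput, hq]

theorem starInput_real (j : Fin d) : (starInput v c).real j = c j := by
  simp [starInput]

theorem relPoint_apply {q : ℕ} (hq : q < n) (j : Fin d) :
    relPoint v c q j = (starInput v c).realArr j q - (starInput v c).real j := by
  rw [starInput_realArr v c hq, starInput_real]
  simp [relPoint, hq]

/-- The invariant of the loop that prepares the data. -/
structure PrepareInv (i : ℕ) (s : State) : Prop where
  natArr : s.natArr = (starInput v c).natArr
  real : s.real = (starInput v c).real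
  coords : ∀ j < d, s.realArr j = (starInput v c).realArr j
  nonneg : ∀ q, 0 ≤ s.realArr d q
  norm : ∀ q < i, s.realArr d q = ‖relPoint v c q‖
  unit : ∀ q < i, ∀ j : Fin d, s.realArr (d + (j + 1)) q = relPoint v c q j / ‖relPoint v c q‖

/-- A point at the center gets the zero vector as its unit vector, by the convention for division by
zero. -/
theorem prepareStep_run {i : ℕ} (hi : i < n) {s : State} (h1 : s.nat 1 = i)
    (h : PrepareInv v c i s) :
    ((prepareStep d).run s).nat = s.nat ∧ PrepareInv v c (i + 1) ((prepareStep d).run s) := by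
  set s₁ := s.storeReal d i ‖relPoint v c i‖ with hs₁
  have e : (prepareStep d).run s = (unitCoords d d).run s₁ := by
    rw [prepareStep, Program.run_seq]
    congr 1
    simp only [Program.run, RExpr.eval, RExpr.eval_sum, NExpr.eval, h1, hs₁]
    congr 1
    rw [EuclideanSpace.norm_eq, ← Fin.sum_univ_eq_sum_range
      (fun j => (s.realArr j i - s.real j) * (s.realArr j i - s.real j)) d]
    congr 1
    refine Finset.sum_congr rfl fun j _ => ?_
    rw [relPoint_apply v c hi, h.coords j j.2, h.real, Real.norm_eq_abs, sq_abs, sq]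
  obtain ⟨h1', h2, h3, h4, h5, h6⟩ := unitCoords_run d d le_rfl s₁
  have t1 : s₁.nat 1 = i := h1
  have t2 : ∀ q, q ≠ i → ∀ t, s₁.realArr t q = s.realArr t q := by
    intro q hq t
    simp only [hs₁, State.storeReal_proj]
    by_cases ht : t = d
    · rw [ht, Function.update_self, Function.update_of_ne hq]
    · rw [Function.update_of_ne ht]
  have t3 : ∀ t < d, s₁.realArr t = s.realArr t := by
    intro t ht
    simp only [hs₁, State.storeReal_proj]
    rw [Function.update_of_ne (by omega)]
  have t4 : s₁.realArr d i = ‖relPoint v c i‖ := by simp [hs₁]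
  rw [t1] at h5 h6
  rw [e]
  refine ⟨h1', h2.trans h.natArr, h3.trans h.real, fun j hj => ?_, fun q => ?_, fun q hq => ?_,
    fun q hq j => ?_⟩
  · rw [h4 j hj.le, t3 j hj, h.coords j hj]
  · rw [h4 d le_rfl]
    by_cases hq : q = i
    · rw [hq, t4]; exact norm_nonneg _
    · rw [t2 q hq]; exact h.nonneg q
  · rw [h4 d le_rfl]
    by_cases hq : q = i
    · rw [hq, t4]
    · rw [t2 q hq]; exact h.norm q (by omega)
  · by_cases hq : q = i
    · rw [hq, h6 j j.2, t4, t3 j j.2, relPoint_apply v c hi, h.coords j j.2]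
      congr 2
      exact congrFun h.real _
    · rw [h5 _ q hq, t2 q hq]; exact h.unit q (by omega) j

theorem prepare_spec (hv : Function.Injective v) :
    Spec (fun s => s = starInput v c) (forLoop (prepareStep d))
      (fun s => s.nat 0 = n ∧ (∃ X, s.realArr = X ∧ PointData d n X (relPoint v c)) ∧
        s.natArr = fun _ _ => 0) (((prepareStep d).bound + 10) * (n + 1)) := by
  refine (Spec.forLoop (p := prepareStep d) ⟨trivial, unitCoords_loopFree d d⟩ n (PrepareInv v c) ?_ ?_).mono
    ?_ ?_ le_rfl
  · exact fun i s h m => ⟨h.natArr, h.real, h.coords, h.nonneg, h.norm, h.unit⟩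
  · intro i s hi h0 h1 h
    obtain ⟨h2, h3⟩ := prepareStep_run v c hi h1 h
    exact ⟨by rw [h2, h0], by rw [h2, h1], h3⟩
  · rintro s rfl
    exact ⟨by simp [starInput], rfl, rfl, fun _ _ => rfl, fun q => by simp [starInput], by omega,
      by omega⟩
  · rintro s ⟨h0, h⟩
    refine ⟨h0, ⟨_, rfl, fun p hp q hq => ?_, h.norm, h.nonneg, h.unit, fun p hp q hq hpq => ?_⟩,
      h.natArr⟩
    · rw [EuclideanSpace.norm_eq, ← Fin.sum_univ_eq_sum_range
        (fun j => (s.realArr j p - s.realArr j q) * (s.realArr j p - s.realArr j q)) d]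
      congr 1
      refine Finset.sum_congr rfl fun j _ => ?_
      rw [PiLp.sub_apply, relPoint_apply v c hp, relPoint_apply v c hq, h.coords j j.2,
        Real.norm_eq_abs, sq_abs, sq]
      ring
    · simp only [relPoint, hp, hq, dif_pos] at hpq
      simpa using hv (sub_left_injective hpq)

end Prepare

/-! ### The whole program. -/

/-- Sorting the points by their first `k` keys. -/
def sortAll (d : ℕ) : ℕ → Program
  | 0 => .skip
  | k + 1 => .seq (sortAll d k) (mergeSort (d + k) (4 * k))

theorem sortAll_spec (d n : ℕ) (X : ℕ → ℕ → ℝ) (k : ℕ) :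
    Spec (fun s => s.nat 0 = n ∧ s.realArr = X ∧ s.natArr = fun _ _ => 0) (sortAll d k)
      (fun s => s.nat 0 = n ∧ s.realArr = X ∧ (∀ t, t % 4 = 2 → s.natArr t = fun _ => 0) ∧
        ∀ j < k, SortedBy (X (d + j)) (s.natArr (4 * j)) n)
      (300 * (n + 1) * (Nat.clog 2 n + 1) * (k + 1)) := by
  induction k with
  | zero =>
    refine (Spec.of_run (p := .skip) trivial ?_).mono (fun s h => h) (fun s h => h) ?_
    · rintro s ⟨h0, h1, h2⟩
      exact ⟨h0, h1, fun t _ => by simp only [Program.run, h2], by omega⟩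
    · simp only [Program.bound]
      exact Nat.succ_le_of_lt (by positivity)
  | succ k ih =>
    intro s hs
    obtain ⟨s', l, hl, ⟨h0, h1, h2, h3⟩, hlb⟩ := ih s hs
    obtain ⟨s'', l', hl', ⟨g0, ⟨g1, g2⟩, g3⟩, hlb'⟩ :=
      mergeSort_spec X s'.natArr (d + k) (4 * k) n (by omega) s' ⟨h0, h1, fun _ _ _ => rfl⟩
    refine ⟨s'', _, .seq hl hl', ⟨g0, g1, fun t ht => ?_, fun j hj => ?_⟩, by linarith⟩
    · rw [g2 t (by omega) (by omega), h2 t ht]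
    · rcases Nat.lt_succ_iff_lt_or_eq.1 hj with hj | rfl
      · rw [g2 _ (by omega) (by omega)]; exact h3 j hj
      · exact g3

/-- The program that computes the dilation of a star. -/
def starProgram (d : ℕ) : Program :=
  .seq (forLoop (prepareStep d)) (.seq (sortAll d (d + 1))
    (.seq (.setReal 0 (.const 1)) (doublingLoop (level d))))

/-- The constant in the running time of `starProgram`. -/
def starCost (d : ℕ) : ℕ :=
  (prepareStep d).bound + 10 + 300 * (d + 2) + 2 +
    (100 * (d + 2) + ((visit d (8 * (2 * d + 3) ^ d)).bound + 10) + 10)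

theorem starProgram_spec {d n : ℕ} (hn : 2 ≤ n) (v : Fin n → EuclideanSpace ℝ (Fin d))
    (hv : Function.Injective v) (c : EuclideanSpace ℝ (Fin d)) :
    Spec (fun s => s = starInput v c) (starProgram d)
      (fun s => 1 ≤ s.real 0 ∧ Attained (relPoint v c) n (s.real 0) ∧
        ∀ p < n, ∀ q < n, p ≠ q → ‖relPoint v c p‖ + ‖relPoint v c q‖ ≤
          s.real 0 * ‖relPoint v c p - relPoint v c q‖)
      (starCost d * ((n + 1) * (Nat.clog 2 n + 1))) := by
  intro s hs
  obtain ⟨s₁, k₁, e₁, ⟨h0, ⟨X, hX, hP⟩, h1⟩, hk₁⟩ := prepare_spec v c hv s hs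
  obtain ⟨s₂, k₂, e₂, ⟨g0, g1, g2, g3⟩, hk₂⟩ := sortAll_spec d n X (d + 1) s₁ ⟨h0, hX, h1⟩
  -- For `d > 0`, register `0` held a coordinate of the center, which is no longer needed. With `w =
  -- 1` there is no pair to account for, so `1` is an admissible start.
  have e₃ := Exec.setReal s₂ 0 (.const 1)
  have hD := Spec.doublingLoop (p := level d) n (LevelInv (relPoint v c) n X)
    (fun i s h m => ⟨h.realArr, h.sorted, h.slot_lt, h.one_le, h.attained, h.found⟩)
    (fun w _ _ => level_spec hP w)
  obtain ⟨s₄, k₄, e₄, ⟨-, w, hw, hL⟩, hk₄⟩ := hD (s₂.setReal 0 1) ⟨g0, by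
    refine ⟨g1, g3, fun m a => ?_, by simp, .inl (by simp), by omega⟩
    simp only [State.setReal_proj, g2 (4 * m + 2) (by omega)]
    omega⟩
  have e₃' : Exec (.setReal 0 (.const 1)) s₂ (s₂.setReal 0 1) 2 := by
    simpa [RExpr.eval, RExpr.cost, State.setReal] using e₃
  refine ⟨s₄, _, .seq e₁ (.seq e₂ (.seq e₃' e₄)), ⟨hL.one_le, hL.attained, ?_⟩, ?_⟩
  · intro p hp q hq hne
    exact sum_norm_le_of_found hL hp hq hne (by omega) (by omega)
  · have hc : 1 ≤ Nat.clog 2 n + 1 := by omega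
    have b1 := Nat.mul_le_mul_left (((prepareStep d).bound + 10) * (n + 1)) hc
    have b2 := Nat.mul_le_mul (show 1 ≤ n + 1 by omega) hc
    have b3 := Nat.mul_le_mul_right (Nat.clog 2 n + 1) (show 10 ≤ 10 * (n + 1) by omega)
    simp only [starCost]
    linarith

end RealRAM

/-! ### Exactness of the output and the bound by `n * log n`. -/

theorem isStarDilation_of_attained {d n : ℕ} (hn : 2 ≤ n) {v : Fin n → EuclideanSpace ℝ (Fin d)}
    (hv : Function.Injective v) {c : EuclideanSpace ℝ (Fin d)} {x : ℝ} (hx : 1 ≤ x)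
    (h : RealRAM.Attained (RealRAM.relPoint v c) n x)
    (hle : ∀ p < n, ∀ q < n, p ≠ q → ‖RealRAM.relPoint v c p‖ + ‖RealRAM.relPoint v c q‖ ≤
      x * ‖RealRAM.relPoint v c p - RealRAM.relPoint v c q‖) :
    IsStarDilation c (Set.range v) x := by
  have hpair : ∀ p q : Fin n, pairDilation c (v p) (v q) =
      (‖RealRAM.relPoint v c p‖ + ‖RealRAM.relPoint v c q‖) /
        ‖RealRAM.relPoint v c p - RealRAM.relPoint v c q‖ := by
    intro p q
    simp [pairDilation, RealRAM.relPoint, dist_eq_norm, norm_sub_rev c]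
  have hpos : ∀ p q : Fin n, v p ≠ v q →
      0 < ‖RealRAM.relPoint v c p - RealRAM.relPoint v c q‖ := by
    intro p q hne
    simp only [RealRAM.relPoint, Fin.is_lt, dif_pos, Fin.eta, sub_sub_sub_cancel_right]
    exact norm_pos_iff.2 (sub_ne_zero.2 hne)
  have hub : ∀ p q : Fin n, v p ≠ v q → pairDilation c (v p) (v q) ≤ x := by
    intro p q hne
    rw [hpair, div_le_iff₀ (hpos p q hne)]
    exact hle p p.2 q q.2 fun h => hne (congrArg v (Fin.ext h))
  refine ⟨?_, ?_⟩
  · rcases h with rfl | ⟨p, hp, q, hq, hne, rfl⟩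
    -- If the start value `1` survives, it is attained by any pair: every dilation is at least `1`
    -- by the triangle inequality.
    · have hne : v ⟨0, by omega⟩ ≠ v ⟨1, by omega⟩ := fun h => by simpa using hv h
      refine ⟨_, ⟨⟨0, by omega⟩, rfl⟩, _, ⟨⟨1, by omega⟩, rfl⟩, hne, le_antisymm ?_ (hub _ _ hne)⟩
      rw [hpair, le_div_iff₀ (hpos _ _ hne), one_mul]
      exact norm_sub_le _ _
    · exact ⟨_, ⟨⟨p, hp⟩, rfl⟩, _, ⟨⟨q, hq⟩, rfl⟩, fun h => hne (by simpa using hv h),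
        (hpair ⟨p, hp⟩ ⟨q, hq⟩).symm⟩
  · rintro y ⟨_, ⟨p, rfl⟩, _, ⟨q, rfl⟩, hne, rfl⟩
    exact hub p q hne

theorem succ_mul_clog_succ_le {n : ℕ} (hn : 2 ≤ n) :
    (((n + 1) * (Nat.clog 2 n + 1) : ℕ) : ℝ) ≤ 12 * ((n : ℝ) * Real.log n) := by
  have h1 : 2 ^ (Nat.clog 2 n - 1) < n := Nat.pow_pred_clog_lt_self (by norm_num) (by omega)
  have hn' : (2 : ℝ) ≤ n := by exact_mod_cast hn
  have hl : Real.log 2 ≤ Real.log n := Real.log_le_log (by norm_num) hn'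
  have hl2 : (1 / 2 : ℝ) < Real.log 2 := by linarith [Real.log_two_gt_d9]
  have h2 : ((Nat.clog 2 n - 1 : ℕ) : ℝ) * Real.log 2 ≤ Real.log n := by
    rw [← Real.log_pow]
    refine Real.log_le_log (by positivity) ?_
    exact_mod_cast h1.le
  have h3 : (Nat.clog 2 n : ℝ) ≤ ((Nat.clog 2 n - 1 : ℕ) : ℝ) + 1 := by
    exact_mod_cast (by omega : Nat.clog 2 n ≤ Nat.clog 2 n - 1 + 1)
  have h4 : ((Nat.clog 2 n - 1 : ℕ) : ℝ) ≤ 2 * Real.log n := by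
    nlinarith [(Nat.cast_nonneg (Nat.clog 2 n - 1) : (0:ℝ) ≤ _)]
  -- Since `Real.log n > 1 / 2`, the remaining summand `2` is at most `4 * Real.log n`.
  have h5 : (Nat.clog 2 n : ℝ) + 1 ≤ 6 * Real.log n := by linarith
  push_cast
  calc ((n : ℝ) + 1) * (Nat.clog 2 n + 1) ≤ (2 * n) * (6 * Real.log n) := by
        gcongr
        linarith
    _ = 12 * ((n : ℝ) * Real.log n) := by ring

theorem theorem1 (d : ℕ) :
    ∃ (P : RealRAM.Program) (C : ℝ),
      ∀ (n : ℕ), 2 ≤ n →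
        ∀ (v : Fin n → EuclideanSpace ℝ (Fin d)), Function.Injective v →
          ∀ (c : EuclideanSpace ℝ (Fin d)),
            ∃ (s : RealRAM.State) (k : ℕ),
              RealRAM.Exec P (starInput v c) s k ∧
              IsStarDilation c (Set.range v) (s.real 0) ∧
              (k : ℝ) ≤ C * ((n : ℝ) * Real.log n) := by
  refine ⟨RealRAM.starProgram d, RealRAM.starCost d * 12, fun n hn v hv c => ?_⟩
  obtain ⟨s, k, e, ⟨h1, h2, h3⟩, hk⟩ := RealRAM.starProgram_spec hn v hv c _ rfl
  refine ⟨s, k, e, isStarDilation_of_attained hn hv h1 h2 h3, ?_⟩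
  have h4 : (k : ℝ) ≤ RealRAM.starCost d * (((n + 1) * (Nat.clog 2 n + 1) : ℕ) : ℝ) := by
    exact_mod_cast hk
  rw [mul_assoc]
  exact h4.trans (mul_le_mul_of_nonneg_left (succ_mul_clog_succ_le hn) (Nat.cast_nonneg _))
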